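/- Model. Base stations form a homogeneous Poisson point process of intensity $\lambda>0$ in the plane $\mathbb R^2$. The typical user sits at the origin and is served by its nearest base station, at distance $r$; the distances of the other base stations are $R_z$. Let $\alpha>2$ be the path-loss exponent, $P>0$ the transmit power, $\sigma^2\ge 0$ the noise power, $\beta\ge 1$ the edge power-control factor, $\Delta\ge 1$ the (integer) number of sub-bands, $\eta=(\Delta-1+\beta)/\Delta$ the effective interference factor, and $T_{\rm FR}>0$ the reuse threshold. All fading powers $g_y,g_z$ (initial sub-band) and $\hat g_y,\hat g_z$ (new sub-band) are i.i.d. exponential with parameter $\mu>0$ (density $\mu e^{-\mu x}$), independent of the base station locations. Put $I_r=\sum_z g_zR_z^{-\alpha}$ and $\hat I_r=\sum_z \hat g_zR_z^{-\alpha}$, sums over all base stations except the serving one. The user is an edge user if $$\frac{P g_y r^{-\alpha}}{\sigma^2+\eta P I_r}<T_{\rm FR};$$ it is then served on a new sub-band with power $\beta P$, and its average rate under soft frequency reuse (SFR) is $$\tau=\mathbb E\left[\ln\left(1+\frac{\beta P\hat g_y r^{-\alpha}}{\sigma^2+\eta P\hat I_r}\right)\,\middle|\,\frac{P g_y r^{-\alpha}}{\sigma^2+\eta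 P I_r}<T_{\rm FR}\right].$$ For $N\ge 0$ and $T,a,b>0$ define $$\rho(T,\alpha)=T^{2/\alpha}\int_{T^{-2/\alpha}}^\infty\frac{du}{1+u^{\alpha/2}},\qquad p_c(T,\lambda,\alpha,\Delta;N)=\pi\lambda\int_0^\infty e^{-\pi\lambda v\left(1+\frac1\Delta\rho(T,\alpha)\right)-\mu T\frac NP v^{\alpha/2}}\,dv,$$ $$\xi(a,b,\alpha)=\int_1^\infty\left[1-\frac1{1+bx^{-\alpha}}\cdot\frac1{1+ax^{-\alpha}}\right]x\,dx,\qquad q(a,b,\lambda,\alpha;N)=\pi\lambda\int_0^\infty e^{-\pi\lambda v(1+2\xi(a,b,\alpha))-\mu(a+b)\frac NP v^{\alpha/2}}\,dv.$$ Theorem (SFR, edge user rate). Almost surely the series $I_r$ and $\hat I_r$ converge, the user is an edge user with positive probability, the rate has a finite conditional mean, and, with $N=\sigma^2/\eta$, $$\tau=\int_0^\infty\frac{p_c\left(\frac\eta\beta(e^t-1),\lambda,\alpha,1;N\right)-q\left(\frac\eta\beta(e^t-1),\eta T_{\rm FR},\lambda,\alpha;N\right)}{1-p_c\left(\eta T_{\rm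 FR},\lambda,\alpha,1;N\right)}\,dt,$$ where the denominator is positive and the integral converges absolutely. -/

import Mathlib

open MeasureTheory ProbabilityTheory Set

noncomputable section

namespace SFR

/-- The Euclidean plane, in which the base stations are placed; the typical user is at the origin. -/
abbrev Plane : Type := EuclideanSpace ℝ (Fin 2)

/-! ### The Poisson network -/

/-- The number of points of the random sequence `X` that lie in the set `B`
(counted with multiplicity). -/
def pointCount {Ω : Type*} (X : ℕ → Ω → Plane) (B : Set Plane) (ω : Ω) : ℕ∞ :=
  {n : ℕ | X n ω ∈ B}.encard

/-- `X` enumerates the points of a homogeneous Poisson point process of intensity `lam`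
in the plane: the number of points in a Borel set of finite area is Poisson distributed with mean
`lam` times the area, and the numbers of points in disjoint Borel sets are independent. -/
structure IsPoissonProcess {Ω : Type*} [MeasurableSpace Ω] (Pr : Measure Ω) (lam : ℝ)
    (X : ℕ → Ω → Plane) : Prop where
  measurable : ∀ n, Measurable (X n)
  count_law : ∀ B : Set Plane, MeasurableSet B → volume B ≠ ⊤ →
    HasLaw (pointCount X B)
      ((poissonMeasure (lam * (volume B).toReal).toNNReal).map (fun k : ℕ => (k : ℕ∞))) Pr
  count_indep : ∀ (m : ℕ) (B : Fin m → Set Plane), (∀ i, MeasurableSet (B i)) →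
    (∀ i, volume (B i) ≠ ⊤) → Pairwise (fun i j => Disjoint (B i) (B j)) →
    iIndepFun (fun i => pointCount X (B i)) Pr

/-- The cellular network seen by the typical user. Base stations `X n` form a Poisson point process
of intensity `lam`; `g n` is the fading power between the user and station `n` on the initial
sub-band and `gNew n` the one on the sub-band that the user gets as an edge user. All fading powers
are exponential with rate `μ` (density `μ * exp (-μ * x)` on `x ≥ 0`), independent of one
another and of the base station locations. -/
structure IsNetwork {Ω : Type*} [MeasurableSpace Ω] (Pr : Measure Ω) (lam μ : ℝ)
    (X : ℕ → Ω → Plane) (g gNew : ℕ → Ω → ℝ) : Prop where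
  poisson : IsPoissonProcess Pr lam X
  measurable_g : ∀ n, Measurable (g n)
  measurable_gNew : ∀ n, Measurable (gNew n)
  law_g : ∀ n, HasLaw (g n) (expMeasure μ) Pr
  law_gNew : ∀ n, HasLaw (gNew n) (expMeasure μ) Pr
  indep_fading : iIndepFun (Sum.elim g gNew) Pr
  indep_locations : IndepFun (fun ω n => X n ω) (fun ω i => Sum.elim g gNew i ω) Pr

/-- The index of the serving station, the base station closest to the origin
(the first one in the enumeration, if there are ties). -/
def serving {Ω : Type*} (X : ℕ → Ω → Plane) (ω : Ω) : ℕ :=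
  sInf {n : ℕ | ∀ m : ℕ, ‖X n ω‖ ≤ ‖X m ω‖}

/-- The term of station `n` in the interference sum: `g_n R_n^(-α)`, where `R_n` is the distance of
station `n`, and `0` for the serving station. -/
def interferer {Ω : Type*} (X : ℕ → Ω → Plane) (h : ℕ → Ω → ℝ) (α : ℝ) (ω : Ω) (n : ℕ) : ℝ :=
  if n = serving X ω then 0 else h n ω * ‖X n ω‖ ^ (-α)

/-- The interference `I_r` from all stations but the serving one, with fading powers `h`. -/
def interference {Ω : Type*} (X : ℕ → Ω → Plane) (h : ℕ → Ω → ℝ) (α : ℝ) (ω : Ω) : ℝ :=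
  ∑' n, interferer X h α ω n

/-- The SINR `S h_y r^(-α) / (noise + Q I_r)` with fading powers `h`, when the serving station
transmits at power `S` and every interfering station at (effective) power `Q`. -/
def sinr {Ω : Type*} (X : ℕ → Ω → Plane) (h : ℕ → Ω → ℝ) (α S noise Q : ℝ) (ω : Ω) : ℝ :=
  S * h (serving X ω) ω * ‖X (serving X ω) ω‖ ^ (-α) / (noise + Q * interference X h α ω)

/-- The effective interference factor `η = (Δ - 1 + β) / Δ` of soft frequency reuse. -/
def effFactor (Δ : ℕ) (β : ℝ) : ℝ := ((Δ : ℝ) - 1 + β) / Δ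

/-- The event that the typical user is an edge user: on the initial sub-band, where its station
transmits at power `P`, its SINR is below the threshold `TFR`. -/
def edgeEvent {Ω : Type*} (X : ℕ → Ω → Plane) (g : ℕ → Ω → ℝ) (α P noise η TFR : ℝ) : Set Ω :=
  {ω | sinr X g α P noise (η * P) ω < TFR}

/-- The rate `ln (1 + SINR)` (in nats/Hz) on the sub-band given to an edge user, on which the
station transmits at power `β P` and all fading powers are new. -/
def edgeRate {Ω : Type*} (X : ℕ → Ω → Plane) (gNew : ℕ → Ω → ℝ) (α P noise η β : ℝ) (ω : Ω) : ℝ :=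
  Real.log (1 + sinr X gNew α (β * P) noise (η * P) ω)

/-! ### The functions in the rate formula -/

/-- `ρ(T, α) = T^(2/α) ∫_{T^(-2/α)}^∞ 1 / (1 + u^(α/2)) du`. -/
def rho (T α : ℝ) : ℝ :=
  T ^ (2 / α) * ∫ u in Ioi (T ^ (-2 / α)), 1 / (1 + u ^ (α / 2))

/-- The coverage probability
`p_c(T, λ, α, Δ) = π λ ∫_0^∞ exp (-π λ v (1 + ρ(T, α) / Δ) - μ T (noise / P) v^(α/2)) dv`. -/
def coverage (μ P noise T lam α Δ : ℝ) : ℝ :=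
  Real.pi * lam * ∫ v in Ioi (0 : ℝ),
    Real.exp (-(Real.pi * lam * v * (1 + 1 / Δ * rho T α)) - μ * T * (noise / P) * v ^ (α / 2))

/-- `ξ(a, b, α) = ∫_1^∞ [1 - 1 / (1 + b x^(-α)) * (1 / (1 + a x^(-α)))] x dx`. -/
def xi (a b α : ℝ) : ℝ :=
  ∫ x in Ioi (1 : ℝ), (1 - 1 / (1 + b * x ^ (-α)) * (1 / (1 + a * x ^ (-α)))) * x

/-- The joint coverage term
`π λ ∫_0^∞ exp (-π λ v (1 + 2 ξ(a, b, α)) - μ (a + b) (noise / P) v^(α/2)) dv`. -/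
def jointCoverage (μ P noise a b lam α : ℝ) : ℝ :=
  Real.pi * lam * ∫ v in Ioi (0 : ℝ),
    Real.exp (-(Real.pi * lam * v * (1 + 2 * xi a b α))
      - μ * (a + b) * (noise / P) * v ^ (α / 2))

/-- The integrand of the rate formula at `t`, for the noise power `noise`. -/
def rateIntegrand (μ P noise lam α η β TFR t : ℝ) : ℝ :=
  (coverage μ P noise (η / β * (Real.exp t - 1)) lam α 1
      - jointCoverage μ P noise (η / β * (Real.exp t - 1)) (η * TFR) lam α)
    / (1 - coverage μ P noise (η * TFR) lam α 1)

end SFR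

end

/-! By the layer-cake formula the mean of the nonnegative rate on the edge event `E` is the integral
over `t > 0` of `Pr (t ≤ rate, E)`. The rate is at least `t` when the new SINR is at least `e^t -
1`, and the complement of `E` says that the initial SINR is at least `TFR`. So everything follows
from the joint tail of the two SINRs, `measure_le_sinr_inter`.

Given the locations, an SINR exceeds a level when one exponential variable exceeds a constant plus a
weighted sum of independent ones. This has probability `exp (-μ * constant) * ∏ 1 / (1 + w_n)` with
weights `w_n = a (r / R_n)^α` (`measure_add_tsum_le`). The two sub-bands are conditionally
independent, so these probabilities multiply (`measure_cover_inter`).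

The mean over the locations is the delicate point, since the weights depend on the nearest distance
`r`. Freeze the `r` in the weights at a value `ρ`. The Laplace functional with infinite cost inside
a disc of radius `r` gives the mean of the product on the event that no station is closer than `r`:
it is `exp (-πλ V(ρ, r))`, where `V` is `voidExponent` (`setLIntegral_expNeg_totalLoss`). Its
decrease in `r` is the weighted density of the nearest distance. A dyadic approximation of the
nearest distance is then put in place of `ρ`, and a limit gives the diagonal formula
(`lintegral_expNeg_totalLoss_nearestDist`).

On the diagonal, scaling gives `V(y, y) = y² (1 + 2ξ)`, and `v = y²` turns the result into
`jointCoverage`; `coverage` is the case where one weight is zero. Convergence of the rate integral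
comes from `rho T α` growing at least like `T^(2/α)`, so that the coverage term decays exponentially
in `t`. -/

namespace SFR

open Filter Topology
open scoped ENNReal NNReal

/-! ### The function `exp (-x)` on `[0, ∞]` -/

/-- The function `x ↦ exp (-x)` on `[0, ∞]`, with value `0` at `∞`. -/
noncomputable def expNeg (x : ℝ≥0∞) : ℝ≥0∞ := EReal.exp (-(x : EReal))

@[simp] lemma expNeg_zero : expNeg 0 = 1 := by simp [expNeg]

@[simp] lemma expNeg_top : expNeg ⊤ = 0 := by simp [expNeg]

lemma expNeg_ofReal {x : ℝ} (hx : 0 ≤ x) :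
    expNeg (ENNReal.ofReal x) = ENNReal.ofReal (Real.exp (-x)) := by
  rw [expNeg, EReal.coe_ennreal_ofReal, max_eq_left hx, ← EReal.coe_neg, EReal.exp_coe]

lemma expNeg_add (x y : ℝ≥0∞) : expNeg (x + y) = expNeg x * expNeg y := by
  rw [expNeg, EReal.coe_ennreal_add, EReal.neg_add, sub_eq_add_neg, EReal.exp_add, expNeg, expNeg]
  · left; simp
  · right; simp

lemma antitone_expNeg : Antitone expNeg := fun x y h => by
  apply EReal.exp_monotone
  rw [EReal.neg_le_neg_iff]
  exact_mod_cast h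

lemma continuous_expNeg : Continuous expNeg :=
  (ENNReal.continuous_exp.comp continuous_neg).comp continuous_coe_ennreal_ereal

@[fun_prop] lemma measurable_expNeg : Measurable expNeg := continuous_expNeg.measurable

lemma expNeg_le_one (x : ℝ≥0∞) : expNeg x ≤ 1 := by
  simpa using antitone_expNeg (zero_le : 0 ≤ x)

lemma expNeg_ne_top (x : ℝ≥0∞) : expNeg x ≠ ⊤ :=
  ((expNeg_le_one x).trans_lt ENNReal.one_lt_top).ne

lemma expNeg_sum {ι : Type*} (s : Finset ι) (f : ι → ℝ≥0∞) :
    expNeg (∑ i ∈ s, f i) = ∏ i ∈ s, expNeg (f i) := by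
  classical
  induction s using Finset.induction_on with
  | empty => simp
  | insert a s ha ih => rw [Finset.sum_insert ha, Finset.prod_insert ha, expNeg_add, ih]

lemma expNeg_natCast_mul (n : ℕ) (x : ℝ≥0∞) : expNeg (n * x) = expNeg x ^ n := by
  have := expNeg_sum (Finset.range n) (fun _ => x)
  simpa using this

/-! ### The Laplace functional of a Poisson process -/

variable {Ω : Type*} [MeasurableSpace Ω]

lemma lintegral_expNeg_poissonMeasure (r : ℝ≥0) {c : ℝ≥0∞} (hc : c ≠ ⊤) :
    ∫⁻ n : ℕ, expNeg (n * c) ∂(poissonMeasure r) = expNeg (r * (1 - expNeg c)) := by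
  obtain ⟨x, rfl⟩ : ∃ x : ℝ≥0, (x : ℝ≥0∞) = c := ⟨c.toNNReal, ENNReal.coe_toNNReal hc⟩
  have h1 : expNeg x = ENNReal.ofReal (Real.exp (-x)) := by
    rw [← expNeg_ofReal x.coe_nonneg, ENNReal.ofReal_coe_nnreal]
  have hle : Real.exp (-(x : ℝ)) ≤ 1 := by simp
  rw [lintegral_countable']
  have h2 : ∀ n : ℕ, expNeg (n * x) * poissonMeasure r {n}
      = ENNReal.ofReal (Real.exp (-r) * ((r * Real.exp (-x)) ^ n / n.factorial)) := by
    intro n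
    rw [expNeg_natCast_mul, h1, poissonMeasure_singleton, ← ENNReal.ofReal_pow (by positivity),
      ← ENNReal.ofReal_mul (by positivity)]
    congr 1
    rw [mul_pow]; ring
  -- What remains is `e^(-r)` times the exponential series at `r e^(-c)`.
  simp_rw [h2]
  have hs := (NormedSpace.expSeries_div_hasSum_exp (r * Real.exp (-x) : ℝ)).mul_left
    (Real.exp (-(r : ℝ)))
  rw [← ENNReal.ofReal_tsum_of_nonneg (fun n => by positivity) hs.summable, hs.tsum_eq,
    ← Real.exp_eq_exp_ℝ, ← Real.exp_add, h1, ← ENNReal.ofReal_one,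
    ← ENNReal.ofReal_sub _ (by positivity), ← ENNReal.ofReal_coe_nnreal,
    ← ENNReal.ofReal_mul (by positivity), expNeg_ofReal]
  · congr 2; ring
  · exact mul_nonneg r.2 (by linarith)

lemma toENNReal_pointCount {Ω : Type*} (X : ℕ → Ω → Plane) (B : Set Plane) (ω : Ω) :
    (pointCount X B ω : ℝ≥0∞) = ∑' n, B.indicator 1 (X n ω) := by
  rw [pointCount, ← ENNReal.tsum_set_one, tsum_subtype {n | X n ω ∈ B} (fun _ => (1 : ℝ≥0∞))]
  rfl

variable {Pr : Measure Ω} {lam : ℝ} {X : ℕ → Ω → Plane}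

lemma IsPoissonProcess.measurable_pointCount (hX : IsPoissonProcess Pr lam X) {B : Set Plane}
    (hB : MeasurableSet B) : Measurable (fun ω => (pointCount X B ω : ℝ≥0∞)) := by
  simp_rw [toENNReal_pointCount]
  exact Measurable.tsum fun n =>
    (measurable_const.indicator hB).comp (hX.measurable n)

lemma lintegral_comp_pointCount (hX : IsPoissonProcess Pr lam X) {B : Set Plane}
    (hB : MeasurableSet B) (hv : volume B ≠ ⊤) (f : ℝ≥0∞ → ℝ≥0∞) :
    ∫⁻ ω, f (pointCount X B ω) ∂Pr
      = ∫⁻ n : ℕ, f n ∂(poissonMeasure (lam * (volume B).toReal).toNNReal) := by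
  have h := (hX.count_law B hB hv).lintegral_comp (f := fun n => f n)
    Measurable.of_discrete.aemeasurable
  rw [h, lintegral_map Measurable.of_discrete Measurable.of_discrete]
  simp

lemma lintegral_expNeg_pointCount (hlam : 0 ≤ lam) (hX : IsPoissonProcess Pr lam X)
    {B : Set Plane} (hB : MeasurableSet B) (hv : volume B ≠ ⊤) {c : ℝ≥0∞} (hc : c ≠ ⊤) :
    ∫⁻ ω, expNeg (c * pointCount X B ω) ∂Pr
      = expNeg (ENNReal.ofReal lam * ((1 - expNeg c) * volume B)) := by
  rw [lintegral_comp_pointCount hX hB hv (fun n => expNeg (c * n))]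
  simp_rw [mul_comm c]
  rw [lintegral_expNeg_poissonMeasure _ hc]
  congr 1
  rw [← ENNReal.ofReal, ENNReal.ofReal_mul hlam, ENNReal.ofReal_toReal hv]
  ring

lemma SimpleFunc.tsum_eq_sum_pointCount {Ω : Type*} {X : ℕ → Ω → Plane}
    (f : SimpleFunc Plane ℝ≥0∞) (ω : Ω) :
    ∑' n, f (X n ω) = ∑ c ∈ f.range, c * pointCount X (f ⁻¹' {c}) ω := by
  simp_rw [toENNReal_pointCount, ← ENNReal.tsum_mul_left]
  rw [← Summable.tsum_finsetSum (fun _ _ => ENNReal.summable)]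
  congr 1 with n
  rw [Finset.sum_eq_single (f (X n ω))]
  · simp
  · intro c _ hc
    simp [indicator, hc.symm]
  · simp

/-- The level sets of the nonzero values are disjoint and of finite area, so their counts are
independent Poisson variables and the mean factors. -/
lemma lintegral_expNeg_tsum_simpleFunc (hlam : 0 ≤ lam) (hX : IsPoissonProcess Pr lam X)
    (f : SimpleFunc Plane ℝ≥0∞) (hf : ∀ x, f x ≠ ⊤) (hv : volume (f ⁻¹' {0}ᶜ) ≠ ⊤) :
    ∫⁻ ω, expNeg (∑' n, f (X n ω)) ∂Pr
      = expNeg (ENNReal.ofReal lam * ∫⁻ x, (1 - expNeg (f x))) := by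
  classical
  -- The value `0` is left out: its level set has infinite area, where `count_law` says nothing, and
  -- it contributes nothing to either side.
  set S := f.range.filter (· ≠ 0) with hS
  have hfin : ∀ c ∈ S, c ≠ ⊤ ∧ volume (f ⁻¹' {c}) ≠ ⊤ := by
    intro c hc
    obtain ⟨hc, h0⟩ := Finset.mem_filter.1 hc
    obtain ⟨x, rfl⟩ := SimpleFunc.mem_range.1 hc
    refine ⟨hf x, measure_ne_top_of_subset (preimage_mono ?_) hv⟩
    simpa using Ne.symm h0
  have hsum : ∀ ω, ∑' n, f (X n ω) = ∑ c ∈ S, c * pointCount X (f ⁻¹' {c}) ω := by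
    intro ω
    rw [SimpleFunc.tsum_eq_sum_pointCount, hS, Finset.sum_filter_of_ne]
    intro c _ h h0
    simp [h0] at h
  have hR : ∫⁻ x, (1 - expNeg (f x)) = ∑ c ∈ S, (1 - expNeg c) * volume (f ⁻¹' {c}) := by
    have := SimpleFunc.map_lintegral (μ := (volume : Measure Plane)) (fun c => 1 - expNeg c) f
    rw [← SimpleFunc.lintegral_eq_lintegral] at this
    simp only [SimpleFunc.coe_map, Function.comp_apply] at this
    rw [this, hS, Finset.sum_filter_of_ne]
    intro c _ h h0
    simp [h0] at h
  simp_rw [hsum, expNeg_sum]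
  have hind : iIndepFun (fun (c : S) ω => expNeg (c * pointCount X (f ⁻¹' {c.1}) ω)) Pr := by
    have h := hX.count_indep S.card (fun i => f ⁻¹' {(S.equivFin.symm i).1})
      (fun i => f.measurableSet_fiber _)
      (fun i => (hfin _ (S.equivFin.symm i).2).2)
      (fun i j hij => by
        refine Disjoint.preimage _ ?_
        rw [disjoint_singleton]
        intro h
        exact hij (S.equivFin.symm.injective (Subtype.ext h)))
    have h2 := h.precomp S.equivFin.injective
    simp only [Equiv.symm_apply_apply] at h2
    exact h2.comp (fun c n => expNeg (c * n)) (fun _ => Measurable.of_discrete)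
  have hprod := lintegral_prod_eq_prod_lintegral_of_indepFun Finset.univ _ hind (fun c =>
    measurable_expNeg.comp
      ((hX.measurable_pointCount (f.measurableSet_fiber _)).const_mul _))
  simp only [Finset.univ_eq_attach, Finset.prod_attach S
    (fun c => ∫⁻ ω, expNeg (c * pointCount X (f ⁻¹' {c}) ω) ∂Pr)] at hprod
  have hpt : ∀ ω, ∏ c ∈ S.attach, expNeg (c.1 * pointCount X (f ⁻¹' {c.1}) ω)
      = ∏ c ∈ S, expNeg (c * pointCount X (f ⁻¹' {c}) ω) := fun ω =>
    Finset.prod_attach S (fun c => expNeg (c * pointCount X (f ⁻¹' {c}) ω))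
  simp_rw [hpt] at hprod
  rw [hprod, hR, Finset.mul_sum, expNeg_sum]
  exact Finset.prod_congr rfl fun c hc =>
    lintegral_expNeg_pointCount hlam hX (f.measurableSet_fiber _) (hfin c hc).2 (hfin c hc).1

lemma tendsto_tsum_of_monotone {f : ℕ → ℕ → ℝ≥0∞} {g : ℕ → ℝ≥0∞}
    (hmono : ∀ n, Monotone fun k => f k n) (hlim : ∀ n, Tendsto (fun k => f k n) atTop (𝓝 (g n))) :
    Tendsto (fun k => ∑' n, f k n) atTop (𝓝 (∑' n, g n)) := by
  simp_rw [← lintegral_count]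
  exact lintegral_tendsto_of_tendsto_of_monotone (fun _ => Measurable.of_discrete.aemeasurable)
    (ae_of_all _ hmono) (ae_of_all _ hlim)

/-- The Laplace functional of a Poisson process. -/
theorem lintegral_expNeg_tsum [IsProbabilityMeasure Pr] (hlam : 0 ≤ lam)
    (hX : IsPoissonProcess Pr lam X) {f : Plane → ℝ≥0∞} (hf : Measurable f) :
    ∫⁻ ω, expNeg (∑' n, f (X n ω)) ∂Pr
      = expNeg (ENNReal.ofReal lam * ∫⁻ x, (1 - expNeg (f x))) := by
  -- Cutting off to balls makes the supports of finite area and keeps the sequence increasing to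
  -- `f`.
  set g : ℕ → SimpleFunc Plane ℝ≥0∞ := fun k =>
    (SimpleFunc.eapprox f k).restrict (Metric.closedBall 0 k) with hg
  have hgval : ∀ k, ⇑(g k) = (Metric.closedBall 0 (k : ℝ)).indicator (SimpleFunc.eapprox f k) :=
    fun k => SimpleFunc.coe_restrict _ Metric.isClosed_closedBall.measurableSet
  have hgmono : ∀ x, Monotone fun k => g k x := by
    intro x k l hkl
    simp only [hgval]
    refine (indicator_le_indicator (SimpleFunc.monotone_eapprox f hkl x)).trans ?_
    exact indicator_le_indicator_of_subset
      (Metric.closedBall_subset_closedBall (by exact_mod_cast hkl)) (fun _ => zero_le) x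
  have hglim : ∀ x, Tendsto (fun k => g k x) atTop (𝓝 (f x)) := by
    intro x
    refine (SimpleFunc.tendsto_eapprox hf x).congr' ?_
    obtain ⟨m, hm⟩ := exists_nat_ge ‖x‖
    filter_upwards [eventually_ge_atTop m] with k hk
    rw [hgval, indicator_of_mem]
    simpa using hm.trans (by exact_mod_cast hk)
  have hL : Tendsto (fun k => ∫⁻ ω, expNeg (∑' n, g k (X n ω)) ∂Pr) atTop
      (𝓝 (∫⁻ ω, expNeg (∑' n, f (X n ω)) ∂Pr)) := by
    refine tendsto_lintegral_of_dominated_convergence (fun _ => 1) (fun k => ?_)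
      (fun k => ae_of_all _ fun ω => expNeg_le_one _) (by simp) (ae_of_all _ fun ω => ?_)
    · exact measurable_expNeg.comp (Measurable.tsum fun n => (g k).measurable.comp (hX.measurable n))
    · exact (continuous_expNeg.tendsto _).comp
        (tendsto_tsum_of_monotone (fun n => hgmono _) (fun n => hglim _))
  have hRint : Tendsto (fun k => ∫⁻ x, (1 - expNeg (g k x))) atTop
      (𝓝 (∫⁻ x, (1 - expNeg (f x)))) := by
    refine lintegral_tendsto_of_tendsto_of_monotone (fun k => ?_) (ae_of_all _ fun x k l hkl => ?_)
      (ae_of_all _ fun x => ?_)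
    · exact (measurable_const.sub (measurable_expNeg.comp (g k).measurable)).aemeasurable
    · exact tsub_le_tsub_left (antitone_expNeg (hgmono x hkl)) _
    · exact ENNReal.Tendsto.sub tendsto_const_nhds
        ((continuous_expNeg.tendsto _).comp (hglim x)) (Or.inl ENNReal.one_ne_top)
  have hR := (continuous_expNeg.tendsto _).comp
    (ENNReal.Tendsto.const_mul (a := ENNReal.ofReal lam) hRint (Or.inr ENNReal.ofReal_ne_top))
  refine tendsto_nhds_unique hL (hR.congr fun k => ?_)
  refine (lintegral_expNeg_tsum_simpleFunc hlam hX (g k) (fun x => ?_) ?_).symm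
  · refine (lt_of_le_of_lt ?_ (SimpleFunc.eapprox_lt_top f k x)).ne
    rw [hgval]
    exact indicator_le_self _ _ _
  · refine measure_ne_top_of_subset (s := Metric.closedBall 0 (k : ℝ)) (fun x hx => ?_)
      (measure_closedBall_lt_top (μ := (volume : Measure Plane))).ne
    rw [mem_preimage, hgval] at hx
    by_contra h
    simp [indicator_of_notMem h] at hx

end SFR

/-! ### Mean measure and local finiteness of the process, the nearest station, convergence of the
interference. -/

namespace SFR

open Filter Topology
open scoped ENNReal NNReal

/-! ### Polar coordinates -/

lemma lintegral_fun_norm_plane {f : ℝ → ℝ≥0∞} (hf : Measurable f) :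
    ∫⁻ x : Plane, f ‖x‖ = ENNReal.ofReal (2 * Real.pi) * ∫⁻ y in Ioi (0 : ℝ), ENNReal.ofReal y * f y := by
  have hdim : Module.finrank ℝ Plane = 2 := by simp [Plane]
  set μ : Measure Plane := volume
  have hsph : μ.toSphere univ = ENNReal.ofReal (2 * Real.pi) := by
    rw [μ.toSphere_apply_univ, hdim, EuclideanSpace.volume_ball_fin_two]
    rw [ENNReal.ofReal_mul zero_le_two]
    simp [ENNReal.ofReal, Real.toNNReal_of_nonneg Real.pi_pos.le]
  calc ∫⁻ x, f ‖x‖ ∂μ = ∫⁻ x : ({(0)}ᶜ : Set Plane), f ‖x.1‖ ∂(μ.comap (↑)) := by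
        rw [lintegral_subtype_comap (measurableSet_singleton _).compl fun x ↦ f ‖x‖,
          restrict_compl_singleton]
    _ = ∫⁻ x, f x.2 ∂μ.toSphere.prod (.volumeIoiPow (Module.finrank ℝ Plane - 1)) := by
        simpa using μ.measurePreserving_homeomorphUnitSphereProd.lintegral_comp_emb
          (Homeomorph.measurableEmbedding _) (f ∘ Subtype.val ∘ Prod.snd)
    _ = μ.toSphere univ * ∫⁻ x : Ioi (0 : ℝ), f x ∂.volumeIoiPow (Module.finrank ℝ Plane - 1) := by
        rw [lintegral_prod _ (by fun_prop)]
        simp [mul_comm]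
    _ = _ := by
        rw [hsph, Measure.volumeIoiPow, lintegral_withDensity_eq_lintegral_mul _ (by fun_prop)
          (by fun_prop), hdim,
          ← lintegral_subtype_comap measurableSet_Ioi (fun y => ENNReal.ofReal y * f y)]
        simp

/-! ### Campbell's formula -/

lemma lintegral_natCast_poissonMeasure (r : ℝ≥0) :
    ∫⁻ n : ℕ, (n : ℝ≥0∞) ∂(poissonMeasure r) = r := by
  rw [lintegral_countable', tsum_eq_zero_add' ENNReal.summable]
  simp only [Nat.cast_zero, zero_mul, zero_add]
  have h : ∀ n : ℕ, ((n + 1 : ℕ) : ℝ≥0∞) * poissonMeasure r {n + 1}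
      = ENNReal.ofReal (r * (Real.exp (-r) * r ^ n / n.factorial)) := by
    intro n
    rw [poissonMeasure_singleton, ← ENNReal.ofReal_natCast, ← ENNReal.ofReal_mul (by positivity)]
    congr 1
    rw [Nat.factorial_succ]
    push_cast
    field_simp
    ring
  simp_rw [h]
  have hs := (hasSum_one_poissonMeasure r).mul_left (r : ℝ)
  rw [← ENNReal.ofReal_tsum_of_nonneg (fun n => by positivity) hs.summable, hs.tsum_eq]
  simp

variable {Ω : Type*} [MeasurableSpace Ω] {Pr : Measure Ω} {lam : ℝ} {X : ℕ → Ω → Plane}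

lemma IsPoissonProcess.measurable_indicator (hX : IsPoissonProcess Pr lam X) {B : Set Plane}
    (hB : MeasurableSet B) (n : ℕ) : Measurable fun ω => B.indicator (1 : Plane → ℝ≥0∞) (X n ω) :=
  (measurable_one.indicator hB).comp (hX.measurable n)

/-- The mean number of points in a set determines the mean measure. Comparison on balls suffices,
and there the counts have a Poisson law with finite mean. -/
lemma sum_map_eq_smul_volume (hlam : 0 ≤ lam) (hX : IsPoissonProcess Pr lam X) :
    Measure.sum (fun n => Pr.map (X n)) = ENNReal.ofReal lam • (volume : Measure Plane) := by
  have hU : ⋃ k : ℕ, Metric.closedBall (0 : Plane) k = univ := Metric.iUnion_closedBall_nat 0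
  refine (Measure.ext_iff_of_iUnion_eq_univ hU).2 fun k => ?_
  ext B hB
  have hB' : MeasurableSet (B ∩ Metric.closedBall (0 : Plane) k) :=
    hB.inter Metric.isClosed_closedBall.measurableSet
  have hfin : volume (B ∩ Metric.closedBall (0 : Plane) k) ≠ ⊤ :=
    measure_ne_top_of_subset inter_subset_right
      (measure_closedBall_lt_top (μ := (volume : Measure Plane))).ne
  rw [Measure.restrict_apply hB, Measure.restrict_apply hB]
  set C := B ∩ Metric.closedBall (0 : Plane) k
  have h1 : ∀ n, Pr.map (X n) C = ∫⁻ ω, C.indicator 1 (X n ω) ∂Pr := by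
    intro n
    rw [← lintegral_map (measurable_one.indicator hB') (hX.measurable n),
      lintegral_indicator_one hB']
  rw [Measure.sum_apply _ hB', Measure.smul_apply, smul_eq_mul]
  simp_rw [h1]
  rw [← lintegral_tsum fun n => (hX.measurable_indicator hB' n).aemeasurable]
  simp_rw [← toENNReal_pointCount]
  rw [lintegral_comp_pointCount hX hB' hfin (fun n => n), lintegral_natCast_poissonMeasure,
    ← ENNReal.ofReal, ENNReal.ofReal_mul hlam, ENNReal.ofReal_toReal hfin]

/-- Campbell's formula for a Poisson process. -/
theorem tsum_lintegral_comp (hlam : 0 ≤ lam) (hX : IsPoissonProcess Pr lam X)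
    {f : Plane → ℝ≥0∞} (hf : Measurable f) :
    ∑' n, ∫⁻ ω, f (X n ω) ∂Pr = ENNReal.ofReal lam * ∫⁻ x, f x := by
  rw [← smul_eq_mul, ← lintegral_smul_measure, ← sum_map_eq_smul_volume hlam hX,
    lintegral_sum_measure]
  simp_rw [lintegral_map hf (hX.measurable _)]

/-- The mean count of every ball is finite. Local finiteness is what makes the nearest station
exist. -/
lemma ae_finite_norm_le (hlam : 0 ≤ lam) (hX : IsPoissonProcess Pr lam X) :
    ∀ᵐ ω ∂Pr, ∀ r : ℝ, {n | ‖X n ω‖ ≤ r}.Finite := by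
  have h : ∀ k : ℕ, ∀ᵐ ω ∂Pr, {n | ‖X n ω‖ ≤ (k : ℝ)}.Finite := by
    intro k
    have hB : MeasurableSet (Metric.closedBall (0 : Plane) k) :=
      Metric.isClosed_closedBall.measurableSet
    have hm := hX.measurable_pointCount hB
    have hlt : ∫⁻ ω, (pointCount X (Metric.closedBall (0 : Plane) k) ω : ℝ≥0∞) ∂Pr ≠ ⊤ := by
      simp_rw [toENNReal_pointCount]
      rw [lintegral_tsum fun n => (hX.measurable_indicator hB n).aemeasurable,
        tsum_lintegral_comp hlam hX (measurable_one.indicator hB), lintegral_indicator_one hB]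
      exact ENNReal.mul_ne_top ENNReal.ofReal_ne_top
        (measure_closedBall_lt_top (μ := (volume : Measure Plane))).ne
    filter_upwards [ae_lt_top hm hlt] with ω hω
    have hω' : pointCount X (Metric.closedBall (0 : Plane) k) ω < ⊤ := by
      simpa using hω
    rw [pointCount, encard_lt_top_iff] at hω'
    simpa using hω'
  filter_upwards [ae_all_iff.2 h] with ω hω r
  obtain ⟨k, hk⟩ := exists_nat_ge r
  exact (hω k).subset fun n (hn : _ ≤ r) => hn.trans hk

lemma ae_ne_zero (hlam : 0 ≤ lam) (hX : IsPoissonProcess Pr lam X) :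
    ∀ᵐ ω ∂Pr, ∀ n, X n ω ≠ 0 := by
  have h := tsum_lintegral_comp hlam hX
    (f := indicator {0} 1) (measurable_one.indicator (measurableSet_singleton 0))
  rw [lintegral_indicator_one (measurableSet_singleton 0), measure_singleton, mul_zero,
    ENNReal.tsum_eq_zero] at h
  refine ae_all_iff.2 fun n => ?_
  have hn := h n
  rw [lintegral_eq_zero_iff (hX.measurable_indicator (measurableSet_singleton 0) n)] at hn
  filter_upwards [hn] with ω hω h0
  simp [h0] at hω

/-! ### The serving station -/

/-- The index of the serving station, as a function of the locations. -/
noncomputable def servingIdx (x : ℕ → Plane) : ℕ := sInf {n : ℕ | ∀ m : ℕ, ‖x n‖ ≤ ‖x m‖}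

/-- Only finitely many points are as close as `x 0`, so the minimum is attained and the `sInf` is
not the default value on an empty set. -/
lemma norm_servingIdx_le {x : ℕ → Plane} (hx : ∀ r : ℝ, {n | ‖x n‖ ≤ r}.Finite) (m : ℕ) :
    ‖x (servingIdx x)‖ ≤ ‖x m‖ := by
  have hne : {n : ℕ | ∀ m : ℕ, ‖x n‖ ≤ ‖x m‖}.Nonempty := by
    obtain ⟨n, hn, hmin⟩ := (hx ‖x 0‖).exists_minimalFor (fun n => ‖x n‖) _ 
      ⟨0, le_refl ‖x 0‖⟩
    refine ⟨n, fun m => ?_⟩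
    rcases le_total ‖x m‖ ‖x 0‖ with h | h
    · by_contra hlt
      exact hlt (hmin h (not_le.1 hlt).le)
    · exact le_trans hn h
  exact Nat.sInf_mem hne m

@[fun_prop] lemma measurable_servingIdx : Measurable servingIdx := by
  classical
  have hS : ∀ n : ℕ, MeasurableSet {x : ℕ → Plane | ∀ m : ℕ, ‖x n‖ ≤ ‖x m‖} := fun n => by
    rw [ofPred_forall]
    exact MeasurableSet.iInter fun m => measurableSet_le (by fun_prop) (by fun_prop)
  -- `Nat.find` needs a solution for every `x`. The second alternative supplies one when there is no
  -- minimizer, and it holds at `0`, in agreement with `sInf ∅ = 0`.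
  have hq : ∀ x : ℕ → Plane, ∃ n, (∀ m : ℕ, ‖x n‖ ≤ ‖x m‖) ∨ ∀ k, ¬ ∀ m : ℕ, ‖x k‖ ≤ ‖x m‖ := by
    intro x
    by_cases h : ∃ n, ∀ m : ℕ, ‖x n‖ ≤ ‖x m‖
    · exact h.imp fun n hn => Or.inl hn
    · exact ⟨0, Or.inr (not_exists.1 h)⟩
  have heq : servingIdx = fun x => Nat.find (hq x) := by
    ext x
    by_cases h : ∃ n, ∀ m : ℕ, ‖x n‖ ≤ ‖x m‖
    · rw [servingIdx, Nat.sInf_def (s := {n : ℕ | ∀ m : ℕ, ‖x n‖ ≤ ‖x m‖}) h]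
      refine Nat.find_congr' fun {n} => ⟨Or.inl, fun hn => hn.resolve_right ?_⟩
      exact not_forall_not.2 h
    · have h0 : {n : ℕ | ∀ m : ℕ, ‖x n‖ ≤ ‖x m‖} = ∅ := by
        ext n; simpa using not_exists.1 h n
      rw [servingIdx, h0, Nat.sInf_empty, eq_comm, Nat.find_eq_zero]
      exact Or.inr (not_exists.1 h)
  rw [heq]
  refine measurable_find hq fun n => ?_
  have hN : MeasurableSet {x : ℕ → Plane | ∀ k, ¬ ∀ m : ℕ, ‖x k‖ ≤ ‖x m‖} := by
    rw [ofPred_forall]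
    exact MeasurableSet.iInter fun k => (hS k).compl
  rw [ofPred_or]
  exact (hS n).union hN

/-! ### Summability of the interference -/

/-- In polar coordinates this is `∫ y^(1-α)` over `y ≥ 1`, finite because `α > 2`. The cut at `1`
removes the singularity at the origin, which is not integrable. -/
lemma lintegral_indicator_norm_rpow_lt_top {α : ℝ} (hα : 2 < α) :
    ∫⁻ x : Plane, (Ici (1 : ℝ)).indicator (fun y => ENNReal.ofReal (y ^ (-α))) ‖x‖ < ⊤ := by
  have hm : Measurable ((Ici (1 : ℝ)).indicator (fun y => ENNReal.ofReal (y ^ (-α)))) :=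
    Measurable.indicator (by fun_prop) measurableSet_Ici
  rw [lintegral_fun_norm_plane hm]
  refine ENNReal.mul_lt_top ENNReal.ofReal_lt_top ?_
  have h1 : ∀ y : ℝ, ENNReal.ofReal y * (Ici (1 : ℝ)).indicator
      (fun y => ENNReal.ofReal (y ^ (-α))) y
      = (Ici (1 : ℝ)).indicator (fun y => ENNReal.ofReal (y ^ (1 - α))) y := by
    intro y
    by_cases hy : 1 ≤ y
    · have hy0 : 0 < y := by linarith
      rw [indicator_of_mem (by exact hy), indicator_of_mem (by exact hy),
        ← ENNReal.ofReal_mul hy0.le, sub_eq_add_neg, Real.rpow_add hy0, Real.rpow_one]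
    · rw [indicator_of_notMem (by exact hy), indicator_of_notMem (by exact hy), mul_zero]
  simp_rw [h1]
  refine (setLIntegral_le_lintegral _ _).trans_lt ?_
  rw [lintegral_indicator measurableSet_Ici, setLIntegral_congr Ioi_ae_eq_Ici.symm]
  exact (integrableOn_Ioi_rpow_of_lt (by linarith) one_pos).lintegral_lt_top

/-- The two families differ only at the serving station and at the stations within distance `1`,
which are finitely many. -/
lemma summable_interferer_of_tsum_ne_top {x : ℕ → Plane} {γ : ℕ → ℝ} {α : ℝ} (s : ℕ)
    (hx : ∀ r : ℝ, {n | ‖x n‖ ≤ r}.Finite) (hγ : ∀ n, 0 ≤ γ n)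
    (hsum : ∑' n, ENNReal.ofReal (γ n)
      * (Ici (1 : ℝ)).indicator (fun y => ENNReal.ofReal (y ^ (-α))) ‖x n‖ ≠ ⊤) :
    Summable fun n => if n = s then 0 else γ n * ‖x n‖ ^ (-α) := by
  refine (ENNReal.summable_toReal hsum).congr_cofinite ?_
  rw [EventuallyEq, eventually_cofinite]
  refine ((hx 1).union (finite_singleton s)).subset fun n hn => ?_
  by_contra hmem
  simp only [mem_union, mem_ofPred_eq, mem_singleton_iff, not_or, not_le] at hmem
  apply hn
  rw [if_neg hmem.2, indicator_of_mem (by exact hmem.1.le), ENNReal.toReal_mul,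
    ENNReal.toReal_ofReal (hγ n), ENNReal.toReal_ofReal (by positivity)]

end SFR

namespace SFR

open Filter Topology
open scoped ENNReal NNReal

/-! ### The exponential distribution -/

lemma expMeasure_eq_withDensity (μ : ℝ) :
    expMeasure μ = volume.withDensity (exponentialPDF μ) := rfl

lemma measurable_exponentialPDF (μ : ℝ) : Measurable (exponentialPDF μ) :=
  (measurable_exponentialPDFReal μ).ennreal_ofReal

lemma expMeasure_Ici {μ t : ℝ} (hμ : 0 < μ) (ht : 0 ≤ t) :
    expMeasure μ (Ici t) = ENNReal.ofReal (Real.exp (-(μ * t))) := by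
  have := isProbabilityMeasure_expMeasure hμ
  have hna : expMeasure μ {t} = 0 := by
    rw [expMeasure_eq_withDensity, withDensity_apply _ (measurableSet_singleton t)]
    simp
  have h1 : expMeasure μ (Ici t) = expMeasure μ (Iic t)ᶜ := by
    rw [compl_Iic]
    refine measure_congr ?_
    exact (Ioi_ae_eq_Ici' hna).symm
  rw [h1, prob_compl_eq_one_sub measurableSet_Iic, ← ofReal_cdf, cdf_expMeasure_eq hμ, if_pos ht,
    ← ENNReal.ofReal_one, ← ENNReal.ofReal_sub _ (by simp; positivity)]
  congr 1
  ring

/-- The threshold ranges over `[0, ∞]`, so that a possibly divergent interference sum can be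
inserted without a case distinction. -/
lemma expMeasure_setOf_le {μ : ℝ} (hμ : 0 < μ) (z : ℝ≥0∞) :
    expMeasure μ {y | z ≤ ENNReal.ofReal y} = expNeg (ENNReal.ofReal μ * z) := by
  have := isProbabilityMeasure_expMeasure hμ
  rcases eq_or_ne z 0 with rfl | h0
  · simp
  rcases eq_or_ne z ⊤ with rfl | htop
  · simp [ENNReal.mul_top, hμ]
  obtain ⟨x, hx, rfl⟩ : ∃ x : ℝ, 0 < x ∧ ENNReal.ofReal x = z :=
    ⟨z.toReal, ENNReal.toReal_pos h0 htop, ENNReal.ofReal_toReal htop⟩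
  have hset : {y | ENNReal.ofReal x ≤ ENNReal.ofReal y} = Ici x := by
    ext y
    rw [mem_ofPred_eq, mem_Ici, ENNReal.ofReal_le_ofReal_iff']
    constructor
    · rintro (h | h)
      · exact h
      · linarith
    · exact Or.inl
  rw [hset, expMeasure_Ici hμ hx.le, ← ENNReal.ofReal_mul hμ.le, expNeg_ofReal (by positivity)]

lemma expMeasure_Iic_zero {μ : ℝ} (hμ : 0 < μ) : expMeasure μ (Iic 0) = 0 := by
  have := isProbabilityMeasure_expMeasure hμ
  rw [← ofReal_cdf, cdf_expMeasure_eq hμ]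
  simp

lemma lintegral_expMeasure_lt_top {μ : ℝ} (hμ : 0 < μ) :
    ∫⁻ y, ENNReal.ofReal y ∂(expMeasure μ) < ⊤ := by
  have hpos : 0 ≤ᵐ[expMeasure μ] (fun y : ℝ => y) := by
    have h := expMeasure_Iic_zero hμ
    have : ∀ᵐ y ∂(expMeasure μ), y ∉ Iic (0 : ℝ) := measure_eq_zero_iff_ae_notMem.1 h
    filter_upwards [this] with y hy
    exact (not_le.1 hy).le
  rw [lintegral_eq_lintegral_meas_le _ hpos aemeasurable_id]
  have h1 : ∀ t ∈ Ioi (0 : ℝ), expMeasure μ {a | t ≤ a} = ENNReal.ofReal (Real.exp (-μ * t)) := by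
    intro t ht
    rw [neg_mul, ← expMeasure_Ici hμ (le_of_lt ht)]
    rfl
  rw [setLIntegral_congr_fun measurableSet_Ioi h1]
  exact (exp_neg_integrableOn_Ioi 0 hμ).lintegral_lt_top

/-- The tilted density is `(1 + w)⁻¹` times the exponential density of rate `μ (1 + w)`. Writing the
value `1 / (1 + w)` as `expNeg` of a logarithm turns later infinite products into sums. -/
lemma lintegral_expNeg_expMeasure {μ w : ℝ} (hμ : 0 < μ) (hw : 0 ≤ w) :
    ∫⁻ y, expNeg (ENNReal.ofReal μ * (ENNReal.ofReal w * ENNReal.ofReal y)) ∂(expMeasure μ)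
      = expNeg (ENNReal.ofReal (Real.log (1 + w))) := by
  have hm : Measurable fun y : ℝ =>
      expNeg (ENNReal.ofReal μ * (ENNReal.ofReal w * ENNReal.ofReal y)) := by fun_prop
  have hw1 : 0 < 1 + w := by positivity
  rw [expMeasure_eq_withDensity, lintegral_withDensity_eq_lintegral_mul _
    (measurable_exponentialPDF μ) hm, expNeg_ofReal (Real.log_nonneg (by linarith)),
    Real.exp_neg, Real.exp_log hw1]
  have h : ∀ y : ℝ, (exponentialPDF μ
        * fun y => expNeg (ENNReal.ofReal μ * (ENNReal.ofReal w * ENNReal.ofReal y))) y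
      = ENNReal.ofReal (1 + w)⁻¹ * exponentialPDF (μ * (1 + w)) y := by
    intro y
    rw [Pi.mul_apply, exponentialPDF_eq, exponentialPDF_eq]
    rcases lt_or_ge y 0 with hy | hy
    · simp [not_le.2 hy]
    · rw [if_pos hy, if_pos hy, ← ENNReal.ofReal_mul hw, ← ENNReal.ofReal_mul hμ.le,
        expNeg_ofReal (by positivity), ← ENNReal.ofReal_mul (by positivity),
        ← ENNReal.ofReal_mul (by positivity)]
      congr 1
      rw [mul_assoc, ← Real.exp_add]
      field_simp
      congr 1
      ring
  simp_rw [h]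
  rw [lintegral_const_mul _ (measurable_exponentialPDF _),
    lintegral_exponentialPDF_eq_one (by positivity), mul_one]

/-! ### Independent fading -/

variable {Ω : Type*} [MeasurableSpace Ω] {Pr : Measure Ω} [IsProbabilityMeasure Pr]

lemma lintegral_expNeg_tsum_of_iIndepFun {a : ℕ → Ω → ℝ≥0∞} {b : ℕ → ℝ≥0∞}
    (hind : iIndepFun a Pr) (ha : ∀ n, Measurable (a n))
    (hab : ∀ n, ∫⁻ ω, expNeg (a n ω) ∂Pr = expNeg (b n)) :
    ∫⁻ ω, expNeg (∑' n, a n ω) ∂Pr = expNeg (∑' n, b n) := by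
  have hL : Tendsto (fun k => ∫⁻ ω, expNeg (∑ n ∈ Finset.range k, a n ω) ∂Pr) atTop
      (𝓝 (∫⁻ ω, expNeg (∑' n, a n ω) ∂Pr)) := by
    refine tendsto_lintegral_of_dominated_convergence (fun _ => 1) (fun k => ?_)
      (fun k => ae_of_all _ fun ω => expNeg_le_one _) (by simp) (ae_of_all _ fun ω => ?_)
    · exact measurable_expNeg.comp (by fun_prop)
    · exact (continuous_expNeg.tendsto _).comp (ENNReal.tendsto_nat_tsum _)
  have hR : Tendsto (fun k => expNeg (∑ n ∈ Finset.range k, b n)) atTop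
      (𝓝 (expNeg (∑' n, b n))) :=
    (continuous_expNeg.tendsto _).comp (ENNReal.tendsto_nat_tsum _)
  refine tendsto_nhds_unique hL (hR.congr fun k => ?_)
  simp_rw [expNeg_sum]
  rw [lintegral_prod_eq_prod_lintegral_of_indepFun _ (fun n ω => expNeg (a n ω))
    (hind.comp (fun _ => expNeg) (fun _ => measurable_expNeg))
    (fun n => measurable_expNeg.comp (ha n))]
  simp_rw [hab]

/-- Independence of two processes is tested on finite subfamilies, where `iIndepFun.indepFun_finset`
applies. -/
lemma indepFun_restrict_of_disjoint {ι : Type*} {f : ι → Ω → ℝ} (hf : iIndepFun f Pr)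
    (hm : ∀ i, Measurable (f i)) {S T : Set ι} (hST : Disjoint S T) :
    IndepFun (fun ω (i : S) => f i ω) (fun ω (i : T) => f i ω) Pr := by
  classical
  refine IndepFun.process_indepFun_process (X := fun i : S => f i) (Y := fun i : T => f i)
    (fun i => hm i) (fun i => hm i) fun I J => ?_
  have hd : Disjoint (I.map (Function.Embedding.subtype (· ∈ S)))
      (J.map (Function.Embedding.subtype (· ∈ T))) := by
    rw [Finset.disjoint_left]
    intro i hi hj
    obtain ⟨i', _, rfl⟩ := Finset.mem_map.1 hi
    obtain ⟨j', _, hj'⟩ := Finset.mem_map.1 hj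
    have hj'' : j'.1 = i'.1 := hj'
    exact disjoint_left.1 hST i'.2 (hj'' ▸ j'.2)
  have h := hf.indepFun_finset _ _ hd hm
  exact h.comp
    (φ := fun (v : I.map (Function.Embedding.subtype (· ∈ S)) → ℝ) (i : I) =>
      v ⟨i.1.1, Finset.mem_map_of_mem _ i.2⟩)
    (ψ := fun (v : J.map (Function.Embedding.subtype (· ∈ T)) → ℝ) (i : J) =>
      v ⟨i.1.1, Finset.mem_map_of_mem _ i.2⟩)
    (measurable_pi_lambda _ fun i => measurable_pi_apply _)
    (measurable_pi_lambda _ fun i => measurable_pi_apply _)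

/-- Integrate out `Y` first: its tail is exponential. -/
lemma measure_le_ofReal_of_indepFun {μ : ℝ} (hμ : 0 < μ) {Z : Ω → ℝ≥0∞} {Y : Ω → ℝ}
    (hZ : Measurable Z) (hY : Measurable Y) (hlaw : HasLaw Y (expMeasure μ) Pr)
    (hind : IndepFun Z Y Pr) :
    Pr {ω | Z ω ≤ ENNReal.ofReal (Y ω)} = ∫⁻ ω, expNeg (ENNReal.ofReal μ * Z ω) ∂Pr := by
  have hE : MeasurableSet {p : ℝ≥0∞ × ℝ | p.1 ≤ ENNReal.ofReal p.2} :=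
    measurableSet_le (by fun_prop) (by fun_prop)
  have h1 : Pr {ω | Z ω ≤ ENNReal.ofReal (Y ω)}
      = Pr.map (fun ω => (Z ω, Y ω)) {p : ℝ≥0∞ × ℝ | p.1 ≤ ENNReal.ofReal p.2} := by
    rw [Measure.map_apply (hZ.prodMk hY) hE]; rfl
  have := isProbabilityMeasure_expMeasure hμ
  have := Measure.isProbabilityMeasure_map (μ := Pr) hZ.aemeasurable
  rw [h1, (indepFun_iff_map_prod_eq_prod_map_map hZ.aemeasurable hY.aemeasurable).1 hind,
    hlaw.map_eq, Measure.prod_apply hE, ← lintegral_map (f := fun z => expNeg (ENNReal.ofReal μ * z))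
      (by fun_prop) hZ]
  exact lintegral_congr fun z => expMeasure_setOf_le hμ z

/-- The probability that an exponential variable exceeds a constant plus a weighted sum of
independent copies of it. -/
lemma measure_add_tsum_le {Ω : Type*} [MeasurableSpace Ω] {Pr : Measure Ω} {μ : ℝ} (hμ : 0 < μ) {h : ℕ → Ω → ℝ} (hm : ∀ n, Measurable (h n))
    (hlaw : ∀ n, HasLaw (h n) (expMeasure μ) Pr) (hind : iIndepFun h Pr) {w : ℕ → ℝ}
    (hw : ∀ n, 0 ≤ w n) {s : ℕ} (hs : w s = 0) (c : ℝ≥0∞) :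
    Pr {ω | c + ∑' n, ENNReal.ofReal (w n) * ENNReal.ofReal (h n ω) ≤ ENNReal.ofReal (h s ω)}
      = expNeg (ENNReal.ofReal μ * c + ∑' n, ENNReal.ofReal (Real.log (1 + w n))) := by
  have := hind.isProbabilityMeasure
  have hZ : Measurable fun ω => c + ∑' n, ENNReal.ofReal (w n) * ENNReal.ofReal (h n ω) :=
    measurable_const.add (Measurable.tsum fun n => by fun_prop)
  have hindep : IndepFun (fun ω => c + ∑' n, ENNReal.ofReal (w n) * ENNReal.ofReal (h n ω))
      (h s) Pr := by
    -- Since `w s = 0`, the sum involves only the coordinates other than `s` and is therefore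
    -- independent of `h s`.
    have hI := indepFun_restrict_of_disjoint hind hm (S := {s}ᶜ) (T := {s}) disjoint_compl_left
    have hI2 := hI.comp
      (φ := fun v : ({s}ᶜ : Set ℕ) → ℝ =>
        c + ∑' n : ({s}ᶜ : Set ℕ), ENNReal.ofReal (w n) * ENNReal.ofReal (v n))
      (ψ := fun v : ({s} : Set ℕ) → ℝ => v ⟨s, mem_singleton s⟩)
      (measurable_const.add (Measurable.tsum fun n => by fun_prop))
      (measurable_pi_apply (X := fun _ : ({s} : Set ℕ) => ℝ) _)
    refine hI2.congr (ae_of_all _ fun ω => ?_) (ae_of_all _ fun ω => rfl)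
    simp only [Function.comp_apply]
    rw [tsum_subtype_eq_of_support_subset
      (f := fun n => ENNReal.ofReal (w n) * ENNReal.ofReal (h n ω))]
    intro n hn hns
    rw [mem_singleton_iff] at hns
    simp [hns, hs] at hn
  rw [measure_le_ofReal_of_indepFun hμ hZ (hm s) (hlaw s) hindep]
  simp_rw [mul_add, expNeg_add, ← ENNReal.tsum_mul_left]
  have hm' : Measurable fun ω => expNeg (∑' n, ENNReal.ofReal μ *
      (ENNReal.ofReal (w n) * ENNReal.ofReal (h n ω))) :=
    measurable_expNeg.comp (Measurable.tsum fun n => by fun_prop)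
  rw [lintegral_const_mul _ hm',
    lintegral_expNeg_tsum_of_iIndepFun (b := fun n => ENNReal.ofReal (Real.log (1 + w n)))]
  · exact hind.comp
      (fun n y => ENNReal.ofReal μ * (ENNReal.ofReal (w n) * ENNReal.ofReal y))
      (fun n => by fun_prop)
  · intro n; fun_prop
  · intro n
    rw [← lintegral_expNeg_expMeasure hμ (hw n)]
    exact (hlaw n).lintegral_comp
      (f := fun y => expNeg (ENNReal.ofReal μ * (ENNReal.ofReal (w n) * ENNReal.ofReal y)))
      (by fun_prop)

end SFR

/-! ### The law of the signals given the locations. -/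

namespace SFR

open Filter Topology
open scoped ENNReal NNReal

variable {Ω : Type*} [MeasurableSpace Ω] {Pr : Measure Ω} {lam μ α : ℝ} {X : ℕ → Ω → Plane}
  {g gNew : ℕ → Ω → ℝ}

/-! ### Almost sure properties of the network -/

/-- The interference from beyond distance `1` has a finite mean: each fading power is independent of
its location, and Campbell's formula sums the location factors. -/
lemma ae_summable_interferer [IsProbabilityMeasure Pr] (hlam : 0 ≤ lam) (hμ : 0 < μ) (hα : 2 < α)
    (hX : IsPoissonProcess Pr lam X) {h : ℕ → Ω → ℝ} (hm : ∀ n, Measurable (h n))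
    (hlaw : ∀ n, HasLaw (h n) (expMeasure μ) Pr) (hind : ∀ n, IndepFun (X n) (h n) Pr)
    (hpos : ∀ᵐ ω ∂Pr, ∀ n, 0 < h n ω) :
    ∀ᵐ ω ∂Pr, Summable (interferer X h α ω) := by
  set φ : Plane → ℝ≥0∞ := fun x => (Ici (1 : ℝ)).indicator (fun y => ENNReal.ofReal (y ^ (-α))) ‖x‖
    with hφ
  have hφm : Measurable φ := (Measurable.indicator (by fun_prop) measurableSet_Ici).comp
    measurable_norm
  have hfm : ∀ n, Measurable fun ω => φ (X n ω) := fun n => hφm.comp (hX.measurable n)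
  have hterm : ∀ n, ∫⁻ ω, ENNReal.ofReal (h n ω) * φ (X n ω) ∂Pr
      = (∫⁻ y, ENNReal.ofReal y ∂(expMeasure μ)) * ∫⁻ ω, φ (X n ω) ∂Pr := by
    intro n
    rw [← (hlaw n).lintegral_comp (by fun_prop)]
    exact lintegral_mul_eq_lintegral_mul_lintegral_of_indepFun (hm n).ennreal_ofReal (hfm n)
      ((hind n).symm.comp ENNReal.measurable_ofReal hφm)
  have hlt : ∫⁻ ω, ∑' n, ENNReal.ofReal (h n ω) * φ (X n ω) ∂Pr ≠ ⊤ := by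
    have hpm : ∀ n, AEMeasurable (fun ω => ENNReal.ofReal (h n ω) * φ (X n ω)) Pr :=
      fun n => ((hm n).ennreal_ofReal.mul (hfm n)).aemeasurable
    rw [lintegral_tsum hpm]
    simp_rw [hterm]
    rw [ENNReal.tsum_mul_left, tsum_lintegral_comp hlam hX hφm]
    exact ENNReal.mul_ne_top (lintegral_expMeasure_lt_top hμ).ne
      (ENNReal.mul_ne_top ENNReal.ofReal_ne_top (lintegral_indicator_norm_rpow_lt_top hα).ne)
  have hmeas : Measurable fun ω => ∑' n, ENNReal.ofReal (h n ω) * φ (X n ω) :=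
    Measurable.tsum fun n => (hm n).ennreal_ofReal.mul (hfm n)
  filter_upwards [ae_lt_top hmeas hlt, ae_finite_norm_le hlam hX, hpos] with ω h1 h2 h3
  exact summable_interferer_of_tsum_ne_top (serving X ω) h2 (fun n => (h3 n).le) h1.ne

lemma ae_forall_pos (hμ : 0 < μ) {h : ℕ → Ω → ℝ} (hlaw : ∀ n, HasLaw (h n) (expMeasure μ) Pr) :
    ∀ᵐ ω ∂Pr, ∀ n, 0 < h n ω := by
  refine ae_all_iff.2 fun n => ?_
  have h0 : ∀ᵐ y ∂(expMeasure μ), y ∉ Iic (0 : ℝ) :=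
    measure_eq_zero_iff_ae_notMem.1 (expMeasure_Iic_zero hμ)
  rw [← (hlaw n).map_eq] at h0
  filter_upwards [ae_of_ae_map (hlaw n).aemeasurable h0] with ω hω
  exact not_le.1 hω

namespace IsNetwork

variable (hnet : IsNetwork Pr lam μ X g gNew)
include hnet

lemma indepFun_location_g (n : ℕ) : IndepFun (X n) (g n) Pr :=
  hnet.indep_locations.comp (measurable_pi_apply n) (measurable_pi_apply (Sum.inl n))

lemma indepFun_location_gNew (n : ℕ) : IndepFun (X n) (gNew n) Pr :=
  hnet.indep_locations.comp (measurable_pi_apply n) (measurable_pi_apply (Sum.inr n))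

lemma iIndepFun_g : iIndepFun g Pr := 
  iIndepFun.precomp (g := Sum.inl) Sum.inl_injective hnet.indep_fading

lemma iIndepFun_gNew : iIndepFun gNew Pr := 
  iIndepFun.precomp (g := Sum.inr) Sum.inr_injective hnet.indep_fading

lemma measurable_fading (i : ℕ ⊕ ℕ) : Measurable (Sum.elim g gNew i) := by
  cases i with
  | inl n => exact hnet.measurable_g n
  | inr n => exact hnet.measurable_gNew n

lemma indepFun_g_gNew : IndepFun (fun ω n => g n ω) (fun ω n => gNew n ω) Pr := by
  have := hnet.indep_fading.isProbabilityMeasure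
  have hI := indepFun_restrict_of_disjoint hnet.indep_fading hnet.measurable_fading
    (S := range Sum.inl) (T := range Sum.inr) isCompl_range_inl_range_inr.disjoint
  exact hI.comp
    (φ := fun (v : (range (Sum.inl : ℕ → ℕ ⊕ ℕ)) → ℝ) n => v ⟨Sum.inl n, mem_range_self n⟩)
    (ψ := fun (v : (range (Sum.inr : ℕ → ℕ ⊕ ℕ)) → ℝ) n => v ⟨Sum.inr n, mem_range_self n⟩)
    (measurable_pi_lambda _ fun n => measurable_pi_apply _)
    (measurable_pi_lambda _ fun n => measurable_pi_apply _)

end IsNetwork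

/-! ### Conditioning on the locations -/

/-- The relative weight of station `n` in the interference: `a (r / R_n)^α`, and `0` for the
serving station. -/
noncomputable def interfWeight (a α : ℝ) (x : ℕ → Plane) (n : ℕ) : ℝ :=
  if n = servingIdx x then 0 else a * (‖x (servingIdx x)‖ / ‖x n‖) ^ α

/-- The locations and fading powers for which the signal dominates noise plus interference. -/
def coverSet (a c α : ℝ) : Set ((ℕ → Plane) × (ℕ → ℝ)) :=
  {p | ENNReal.ofReal (c * ‖p.1 (servingIdx p.1)‖ ^ α)
      + ∑' n, ENNReal.ofReal (interfWeight a α p.1 n) * ENNReal.ofReal (p.2 n)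
    ≤ ENNReal.ofReal (p.2 (servingIdx p.1))}

lemma measurable_apply_servingIdx {β : Type*} [MeasurableSpace β] :
    Measurable fun p : (ℕ → Plane) × (ℕ → β) => p.2 (servingIdx p.1) := by
  have h : Measurable fun q : (ℕ → β) × ℕ => q.1 q.2 :=
    measurable_from_prod_countable_left fun n => measurable_pi_apply n
  exact h.comp (measurable_snd.prodMk (measurable_servingIdx.comp measurable_fst))

@[fun_prop] lemma measurable_norm_servingIdx :
    Measurable fun x : ℕ → Plane => ‖x (servingIdx x)‖ :=
  (measurable_apply_servingIdx.comp (measurable_id.prodMk measurable_id)).norm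

@[fun_prop] lemma measurable_interfWeight (a α : ℝ) (n : ℕ) :
    Measurable fun x => interfWeight a α x n :=
  Measurable.ite (measurableSet_eq_fun measurable_const measurable_servingIdx) measurable_const
    (by fun_prop)

lemma measurableSet_coverSet (a c α : ℝ) : MeasurableSet (coverSet a c α) := by
  have h1 : Measurable fun p : (ℕ → Plane) × (ℕ → ℝ) =>
      ENNReal.ofReal (c * ‖p.1 (servingIdx p.1)‖ ^ α) :=
    (show Measurable fun x : ℕ → Plane => ENNReal.ofReal (c * ‖x (servingIdx x)‖ ^ α) by
      fun_prop).comp measurable_fst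
  have h2 : ∀ n, Measurable fun p : (ℕ → Plane) × (ℕ → ℝ) =>
      ENNReal.ofReal (interfWeight a α p.1 n) * ENNReal.ofReal (p.2 n) := fun n =>
    ((measurable_interfWeight a α n).comp measurable_fst).ennreal_ofReal.mul (by fun_prop)
  exact measurableSet_le (h1.add (Measurable.tsum h2)) measurable_apply_servingIdx.ennreal_ofReal

lemma interfWeight_nonneg {a : ℝ} (ha : 0 ≤ a) (x : ℕ → Plane) (n : ℕ) :
    0 ≤ interfWeight a α x n := by
  unfold interfWeight
  split_ifs <;> positivity

/-- The conditional probability, given the locations, that the signal dominates noise plus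
interference. -/
noncomputable def condCover (μ a c α : ℝ) (x : ℕ → Plane) : ℝ≥0∞ :=
  expNeg (ENNReal.ofReal μ * ENNReal.ofReal (c * ‖x (servingIdx x)‖ ^ α)
    + ∑' n, ENNReal.ofReal (Real.log (1 + interfWeight a α x n)))

lemma measure_mem_coverSet [IsProbabilityMeasure Pr] (hμ : 0 < μ) {h : ℕ → Ω → ℝ}
    (hm : ∀ n, Measurable (h n)) (hlaw : ∀ n, HasLaw (h n) (expMeasure μ) Pr)
    (hind : iIndepFun h Pr) {a : ℝ} (ha : 0 ≤ a) (c : ℝ) (x : ℕ → Plane) :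
    Pr {ω | (x, fun n => h n ω) ∈ coverSet a c α} = condCover μ a c α x :=
  measure_add_tsum_le hμ hm hlaw hind (w := interfWeight a α x) (interfWeight_nonneg ha x)
    (if_pos rfl) (ENNReal.ofReal (c * ‖x (servingIdx x)‖ ^ α))

/-- The probability that both signals dominate, as a mean over the locations. -/
lemma IsNetwork.measure_cover_inter (hnet : IsNetwork Pr lam μ X g gNew) (hμ : 0 < μ) {a b : ℝ}
    (ha : 0 ≤ a) (hb : 0 ≤ b) (c d : ℝ) :
    Pr ({ω | (fun n => X n ω, fun n => gNew n ω) ∈ coverSet a c α}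
        ∩ {ω | (fun n => X n ω, fun n => g n ω) ∈ coverSet b d α})
      = ∫⁻ ω, condCover μ a c α (fun n => X n ω) * condCover μ b d α (fun n => X n ω) ∂Pr := by
  have := hnet.indep_fading.isProbabilityMeasure
  have hXm : Measurable fun ω n => X n ω := measurable_pi_lambda _ hnet.poisson.measurable
  have hGm : Measurable fun ω i => Sum.elim g gNew i ω :=
    measurable_pi_lambda _ hnet.measurable_fading
  -- Locations and fading are independent, so their joint law is a product and the probability of
  -- `E` is the mean of its sections at fixed locations.
  set E : Set ((ℕ → Plane) × (ℕ ⊕ ℕ → ℝ)) :=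
    {p | (p.1, fun n => p.2 (Sum.inr n)) ∈ coverSet a c α}
      ∩ {p | (p.1, fun n => p.2 (Sum.inl n)) ∈ coverSet b d α} with hE
  have hEm : MeasurableSet E := by
    refine MeasurableSet.inter ?_ ?_
    · exact (measurableSet_coverSet a c α).preimage (by fun_prop)
    · exact (measurableSet_coverSet b d α).preimage (by fun_prop)
  have h1 : Pr ({ω | (fun n => X n ω, fun n => gNew n ω) ∈ coverSet a c α}
        ∩ {ω | (fun n => X n ω, fun n => g n ω) ∈ coverSet b d α})
      = Pr.map (fun ω => (fun n => X n ω, fun i => Sum.elim g gNew i ω)) E := by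
    rw [Measure.map_apply (hXm.prodMk hGm) hEm]
    rfl
  have := Measure.isProbabilityMeasure_map (μ := Pr) hXm.aemeasurable
  have := Measure.isProbabilityMeasure_map (μ := Pr) hGm.aemeasurable
  rw [h1, (indepFun_iff_map_prod_eq_prod_map_map hXm.aemeasurable hGm.aemeasurable).1
    hnet.indep_locations, Measure.prod_apply hEm, lintegral_map (measurable_measure_prodMk_left hEm) hXm]
  refine lintegral_congr fun ω => ?_
  generalize (fun n => X n ω) = x
  rw [Measure.map_apply hGm (measurable_prodMk_left hEm)]
  have hsec : ∀ a c : ℝ, MeasurableSet {γ : ℕ → ℝ | (x, γ) ∈ coverSet a c α} := fun a c =>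
    measurable_prodMk_left (measurableSet_coverSet a c α)
  -- At fixed locations the two conditions concern different sub-bands, hence independent fading.
  have hind := hnet.indepFun_g_gNew.symm.measure_inter_preimage_eq_mul _ _ (hsec a c) (hsec b d)
  rw [← measure_mem_coverSet hμ hnet.measurable_gNew hnet.law_gNew hnet.iIndepFun_gNew ha c x,
    ← measure_mem_coverSet hμ hnet.measurable_g hnet.law_g hnet.iIndepFun_g hb d x]
  exact hind

end SFR

/-! ### Calculus of the exponent as a function of the radius and of the frozen distance. -/

namespace SFR

open Filter Topology
open scoped ENNReal NNReal

/-! ### Laplace transform of the interference of one station -/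

/-- The mean of `exp (-s g y^(-α))` for two independent fading powers, where the relative weights
of a station at distance `y` are `a (ρ / y)^α` and `b (ρ / y)^α`. -/
noncomputable def survival (a b α ρ y : ℝ) : ℝ :=
  1 / (1 + b * (ρ / y) ^ α) * (1 / (1 + a * (ρ / y) ^ α))

/-- The exponent, up to the factor `π λ`, of the joint Laplace transform of having no station
closer than `r` and of the interference. -/
noncomputable def voidExponent (a b α ρ r : ℝ) : ℝ :=
  r ^ 2 + 2 * ∫ z in Ioi r, (1 - survival a b α ρ z) * z

/-- The density of the distance of the nearest station, weighted with the Laplace transform of the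
interference. -/
noncomputable def nearestDensity (lam a b α ρ y : ℝ) : ℝ :=
  2 * Real.pi * lam * y * survival a b α ρ y
    * Real.exp (-(Real.pi * lam * voidExponent a b α ρ y))

section Analysis

variable {a b α ρ r y lam : ℝ}

lemma survival_pos (ha : 0 ≤ a) (hb : 0 ≤ b) (hρ : 0 ≤ ρ) (hy : 0 ≤ y) :
    0 < survival a b α ρ y := by
  unfold survival; positivity

lemma survival_le_one (ha : 0 ≤ a) (hb : 0 ≤ b) (hρ : 0 ≤ ρ) (hy : 0 ≤ y) :
    survival a b α ρ y ≤ 1 := by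
  have h : 0 ≤ (ρ / y) ^ α := by positivity
  unfold survival
  have h1 : 1 / (1 + b * (ρ / y) ^ α) ≤ 1 := by
    rw [div_le_one (by positivity)]; nlinarith [mul_nonneg hb h]
  have h2 : 1 / (1 + a * (ρ / y) ^ α) ≤ 1 := by
    rw [div_le_one (by positivity)]; nlinarith [mul_nonneg ha h]
  exact mul_le_one₀ h1 (by positivity) h2

lemma one_sub_survival_le (ha : 0 ≤ a) (hb : 0 ≤ b) (hρ : 0 ≤ ρ) (hy : 0 ≤ y) :
    1 - survival a b α ρ y ≤ (a + b) * (ρ / y) ^ α := by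
  have h : 0 ≤ (ρ / y) ^ α := by positivity
  have hA := mul_nonneg ha h
  have hB := mul_nonneg hb h
  unfold survival
  rw [add_mul]
  set A := a * (ρ / y) ^ α
  set B := b * (ρ / y) ^ α
  have h0 : 1 - 1 / (1 + B) * (1 / (1 + A)) = (A + B + A * B) / ((1 + B) * (1 + A)) := by
    field_simp; ring
  rw [h0, div_le_iff₀ (by positivity)]
  nlinarith [mul_nonneg hA hB, mul_nonneg (mul_nonneg hA hB) hA, mul_nonneg (mul_nonneg hA hB) hB]

lemma survival_antitone (ha : 0 ≤ a) (hb : 0 ≤ b) (hα : 0 ≤ α) (hρ : 0 ≤ ρ) (hy : 0 ≤ y) {ρ' : ℝ}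
    (hρ' : ρ ≤ ρ') : survival a b α ρ' y ≤ survival a b α ρ y := by
  unfold survival
  have h : (ρ / y) ^ α ≤ (ρ' / y) ^ α := by gcongr
  have h0 : 0 ≤ (ρ / y) ^ α := by positivity
  have h1 : 0 ≤ 1 / (1 + a * (ρ' / y) ^ α) := by
    have := h0.trans h
    positivity
  gcongr

@[fun_prop] lemma measurable_survival {β : Type*} [MeasurableSpace β] {f g : β → ℝ}
    (hf : Measurable f) (hg : Measurable g) :
    Measurable fun x => survival a b α (f x) (g x) := by
  unfold survival; fun_prop

lemma continuousAt_survival_left (ha : 0 ≤ a) (hb : 0 ≤ b) (hα : 0 < α) (hρ : 0 ≤ ρ) (hy : 0 ≤ y) :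
    ContinuousAt (fun ρ => survival a b α ρ y) ρ := by
  have h : ContinuousAt (fun ρ => (ρ / y) ^ α) ρ :=
    ContinuousAt.rpow_const (by fun_prop) (Or.inr hα.le)
  have h0 : 0 ≤ (ρ / y) ^ α := by positivity
  unfold survival
  have h1 : 1 + b * (ρ / y) ^ α ≠ 0 := by positivity
  have h2 : 1 + a * (ρ / y) ^ α ≠ 0 := by positivity
  fun_prop (disch := assumption)

lemma continuousAt_survival_right (ha : 0 ≤ a) (hb : 0 ≤ b) (hα : 0 < α) (hρ : 0 ≤ ρ)
    (hy : 0 < y) : ContinuousAt (fun y => survival a b α ρ y) y := by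
  have h : ContinuousAt (fun y => (ρ / y) ^ α) y :=
    ContinuousAt.rpow_const (continuousAt_const.div continuousAt_id hy.ne') (Or.inr hα.le)
  have h0 : 0 ≤ (ρ / y) ^ α := by positivity
  unfold survival
  have h1 : 1 + b * (ρ / y) ^ α ≠ 0 := by positivity
  have h2 : 1 + a * (ρ / y) ^ α ≠ 0 := by positivity
  fun_prop (disch := assumption)

/-- The integrand is at most `1` on `(0, 1]` and at most a multiple of `z^(1-α)` beyond. -/
lemma integrableOn_one_sub_survival_mul (ha : 0 ≤ a) (hb : 0 ≤ b) (hα : 2 < α) (hρ : 0 ≤ ρ)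
    (hr : 0 ≤ r) : IntegrableOn (fun z => (1 - survival a b α ρ z) * z) (Ioi r) := by
  have hm : Measurable fun z => (1 - survival a b α ρ z) * z := by fun_prop
  suffices h : IntegrableOn (fun z => (1 - survival a b α ρ z) * z) (Ioi 0) from
    h.mono_set (Ioi_subset_Ioi hr)
  rw [← Ioc_union_Ioi_eq_Ioi zero_le_one]
  refine IntegrableOn.union ?_ ?_
  · refine Measure.integrableOn_of_bounded (M := 1) (by simp) hm.aestronglyMeasurable ?_
    refine (ae_restrict_iff' measurableSet_Ioc).2 (ae_of_all _ fun z hz => ?_)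
    have h1 := survival_le_one (α := α) ha hb hρ hz.1.le
    have h2 := survival_pos (α := α) ha hb hρ hz.1.le
    rw [Real.norm_of_nonneg (mul_nonneg (by linarith) hz.1.le)]
    nlinarith [hz.1, hz.2]
  · have hg : IntegrableOn (fun z : ℝ => (a + b) * ρ ^ α * z ^ (1 - α)) (Ioi 1) :=
      (integrableOn_Ioi_rpow_of_lt (by linarith) one_pos).const_mul _
    refine Integrable.mono' hg hm.aestronglyMeasurable ?_
    refine (ae_restrict_iff' measurableSet_Ioi).2 (ae_of_all _ fun z hz => ?_)
    have hz0 : 0 < z := one_pos.trans hz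
    have h1 := survival_le_one (α := α) ha hb hρ hz0.le
    have h2 := one_sub_survival_le (α := α) ha hb hρ hz0.le
    rw [Real.norm_of_nonneg (mul_nonneg (by linarith) hz0.le)]
    refine (mul_le_mul_of_nonneg_right h2 hz0.le).trans_eq ?_
    rw [Real.div_rpow hρ hz0.le, sub_eq_add_neg, Real.rpow_add hz0, Real.rpow_one,
      Real.rpow_neg hz0.le]
    ring

lemma sq_le_voidExponent (ha : 0 ≤ a) (hb : 0 ≤ b) (hρ : 0 ≤ ρ) (hr : 0 ≤ r) :
    r ^ 2 ≤ voidExponent a b α ρ r := by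
  unfold voidExponent
  have : 0 ≤ ∫ z in Ioi r, (1 - survival a b α ρ z) * z := by
    refine setIntegral_nonneg measurableSet_Ioi fun z hz => ?_
    have hz0 : 0 ≤ z := hr.trans (le_of_lt hz)
    have h1 := survival_le_one (α := α) ha hb hρ hz0
    exact mul_nonneg (by linarith) hz0
  linarith

/-- A tail integral becomes a constant minus a primitive, ready for continuity and differentiation
in `r`. -/
lemma voidExponent_eq (ha : 0 ≤ a) (hb : 0 ≤ b) (hα : 2 < α) (hρ : 0 ≤ ρ) (hr : 0 ≤ r) :
    voidExponent a b α ρ r = r ^ 2 + 2 * ((∫ z in Ioi 0, (1 - survival a b α ρ z) * z)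
      - ∫ z in 0..r, (1 - survival a b α ρ z) * z) := by
  rw [voidExponent, ← intervalIntegral.integral_Ioi_sub_Ioi
    (integrableOn_one_sub_survival_mul ha hb hα hρ le_rfl) hr]
  ring

lemma continuousOn_voidExponent (ha : 0 ≤ a) (hb : 0 ≤ b) (hα : 2 < α) (hρ : 0 ≤ ρ) :
    ContinuousOn (voidExponent a b α ρ) (Icc 0 r) := by
  rcases lt_or_ge r 0 with hr | hr
  · simp [Icc_eq_empty_of_lt hr]
  have h := intervalIntegral.continuousOn_primitive_interval' (μ := volume) (a := 0)
    (((intervalIntegrable_iff_integrableOn_Ioc_of_le hr).2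
      ((integrableOn_one_sub_survival_mul ha hb hα hρ le_rfl).mono_set Ioc_subset_Ioi_self)))
    left_mem_uIcc
  rw [uIcc_of_le hr] at h
  refine ContinuousOn.congr (f := fun r => r ^ 2 + 2 * ((∫ z in Ioi 0, (1 - survival a b α ρ z) * z)
      - ∫ z in 0..r, (1 - survival a b α ρ z) * z)) ?_ fun y hy =>
    voidExponent_eq ha hb hα hρ hy.1
  fun_prop

lemma hasDerivAt_voidExponent (ha : 0 ≤ a) (hb : 0 ≤ b) (hα : 2 < α) (hρ : 0 ≤ ρ) (hy : 0 < y) :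
    HasDerivAt (voidExponent a b α ρ) (2 * y * survival a b α ρ y) y := by
  have hI : IntervalIntegrable (fun z => (1 - survival a b α ρ z) * z) volume 0 y :=
    (intervalIntegrable_iff_integrableOn_Ioc_of_le hy.le).2
      ((integrableOn_one_sub_survival_mul ha hb hα hρ le_rfl).mono_set Ioc_subset_Ioi_self)
  have hm : Measurable fun z => (1 - survival a b α ρ z) * z := by fun_prop
  have h := intervalIntegral.integral_hasDerivAt_right hI
    hm.stronglyMeasurable.stronglyMeasurableAtFilter
    ((continuousAt_const.sub (continuousAt_survival_right ha hb (by linarith) hρ hy)).mul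
      continuousAt_id)
  have h2 := ((hasDerivAt_id y).pow 2).add
    (((hasDerivAt_const y (∫ z in Ioi 0, (1 - survival a b α ρ z) * z)).sub h).const_mul 2)
  refine (h2.congr_deriv ?_).congr_of_eventuallyEq ?_
  · simp; ring
  · filter_upwards [Ioi_mem_nhds hy] with z hz
    simpa using voidExponent_eq ha hb hα hρ (le_of_lt hz)

/-- `nearestDensity` is minus the derivative of the exponential, and a nonnegative derivative is
integrable. The derivative is needed only on the open interval, so `r = 0` is allowed. -/
lemma ofReal_exp_voidExponent (hlam : 0 ≤ lam) (ha : 0 ≤ a) (hb : 0 ≤ b) (hα : 2 < α)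
    (hρ : 0 ≤ ρ) (hr : 0 ≤ r) {r' : ℝ} (hr' : r ≤ r') :
    ENNReal.ofReal (Real.exp (-(Real.pi * lam * voidExponent a b α ρ r)))
      = (∫⁻ y in Ico r r', ENNReal.ofReal (nearestDensity lam a b α ρ y))
        + ENNReal.ofReal (Real.exp (-(Real.pi * lam * voidExponent a b α ρ r'))) := by
  have hcont : ContinuousOn (fun y => -Real.exp (-(Real.pi * lam * voidExponent a b α ρ y)))
      (Icc r r') := by
    have := (continuousOn_voidExponent (r := r') ha hb hα hρ).mono (Icc_subset_Icc_left hr)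
    fun_prop
  have hderiv : ∀ y ∈ Ioo r r', HasDerivAt
      (fun y => -Real.exp (-(Real.pi * lam * voidExponent a b α ρ y)))
      (nearestDensity lam a b α ρ y) y := by
    intro y hy
    have h := hasDerivAt_voidExponent ha hb hα hρ (hr.trans_lt hy.1)
    refine ((h.const_mul (Real.pi * lam)).neg.exp.neg).congr_deriv ?_
    unfold nearestDensity; simp only [Pi.neg_apply]; ring
  have hpos : ∀ y ∈ Icc r r', 0 ≤ nearestDensity lam a b α ρ y := by
    intro y hy
    have hy0 := hr.trans hy.1
    have := survival_pos (α := α) ha hb hρ hy0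
    unfold nearestDensity
    positivity
  have hint := intervalIntegral.integrableOn_deriv_of_nonneg hcont hderiv
    (fun y hy => hpos y (Ioo_subset_Icc_self hy))
  have hval := intervalIntegral.integral_eq_sub_of_hasDerivAt_of_le hr' hcont hderiv
    ((intervalIntegrable_iff_integrableOn_Ioc_of_le hr').2 hint)
  rw [intervalIntegral.integral_of_le hr'] at hval
  have hnn : 0 ≤ᵐ[volume.restrict (Ioc r r')] nearestDensity lam a b α ρ :=
    (ae_restrict_iff' measurableSet_Ioc).2 (ae_of_all _ fun y hy => hpos y (Ioc_subset_Icc_self hy))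
  rw [setLIntegral_congr Ico_ae_eq_Ioc, ← ofReal_integral_eq_lintegral_ofReal hint hnn,
    ← ENNReal.ofReal_add (integral_nonneg_of_ae hnn) (by positivity), hval]
  congr 1
  ring

lemma measurable_nearestDensity {β : Type*} [MeasurableSpace β] {f g : β → ℝ}
    (hf : Measurable f) (hg : Measurable g) :
    Measurable fun x => nearestDensity lam a b α (f x) (g x) := by
  have h1 : Measurable fun p : (ℝ × ℝ) × ℝ =>
      (Ioi p.1.2).indicator (fun z => (1 - survival a b α p.1.1 z) * z) p.2 :=
    Measurable.ite (measurableSet_lt measurable_fst.snd measurable_snd) (by fun_prop)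
      measurable_const
  have h2 : Measurable fun p : ℝ × ℝ => voidExponent a b α p.1 p.2 := by
    unfold voidExponent
    simp_rw [← integral_indicator measurableSet_Ioi]
    have := (h1.stronglyMeasurable.integral_prod_right' (ν := (volume : Measure ℝ))).measurable
    fun_prop
  have h3 : Measurable fun x => voidExponent a b α (f x) (g x) := h2.comp (hf.prodMk hg)
  unfold nearestDensity
  fun_prop

/-- Approximation from below keeps the integrands under the one for `ρ`, because `survival`
decreases in its frozen distance. -/
lemma tendsto_voidExponent (ha : 0 ≤ a) (hb : 0 ≤ b) (hα : 2 < α) (hρ : 0 ≤ ρ) (hr : 0 ≤ r)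
    {u : ℕ → ℝ} (hu0 : ∀ j, 0 ≤ u j) (hu : ∀ j, u j ≤ ρ) (hlim : Tendsto u atTop (𝓝 ρ)) :
    Tendsto (fun j => voidExponent a b α (u j) r) atTop (𝓝 (voidExponent a b α ρ r)) := by
  unfold voidExponent
  refine Tendsto.const_add _ (Tendsto.const_mul _ ?_)
  refine tendsto_integral_of_dominated_convergence (fun z => (1 - survival a b α ρ z) * z)
    (fun j => (by fun_prop : Measurable fun z => (1 - survival a b α (u j) z) * z).aestronglyMeasurable)
    (integrableOn_one_sub_survival_mul ha hb hα hρ hr) (fun j => ?_) ?_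
  · refine (ae_restrict_iff' measurableSet_Ioi).2 (ae_of_all _ fun z hz => ?_)
    have hz0 : 0 ≤ z := hr.trans (le_of_lt hz)
    have h1 := survival_le_one (α := α) ha hb (hu0 j) hz0
    have h2 := survival_antitone (α := α) ha hb (by linarith) (hu0 j) hz0 (hu j)
    rw [Real.norm_of_nonneg (mul_nonneg (by linarith) hz0)]
    gcongr
  · refine (ae_restrict_iff' measurableSet_Ioi).2 (ae_of_all _ fun z hz => ?_)
    have hz0 : 0 ≤ z := hr.trans (le_of_lt hz)
    exact ((continuousAt_survival_left ha hb (by linarith) hρ hz0).tendsto.comp hlim).const_sub _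
      |>.mul_const _

/-- Substitute `z = y x`: on the diagonal the ratio `y / z` depends on `x` alone. -/
lemma voidExponent_self (hy : 0 < y) :
    voidExponent a b α y y = y ^ 2 * (1 + 2 * xi a b α) := by
  have h := integral_comp_mul_left_Ioi (fun z => (1 - survival a b α y z) * z) 1 hy
  rw [mul_one, smul_eq_mul] at h
  have h2 : ∫ x in Ioi (1 : ℝ), (1 - survival a b α y (y * x)) * (y * x) = y * xi a b α := by
    rw [xi, ← integral_const_mul]
    refine setIntegral_congr_fun measurableSet_Ioi fun x hx => ?_
    have hx0 : (0 : ℝ) < x := one_pos.trans hx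
    have h3 : (y / (y * x)) ^ α = x ^ (-α) := by
      rw [div_mul_cancel_left₀ hy.ne', Real.inv_rpow hx0.le, Real.rpow_neg hx0.le]
    simp only [survival, h3]
    ring
  rw [h2] at h
  have h4 : ∫ z in Ioi y, (1 - survival a b α y z) * z = y ^ 2 * xi a b α := by
    rw [sq, mul_assoc, h, mul_inv_cancel_left₀ hy.ne']
  rw [voidExponent, h4]
  ring

end Analysis

end SFR

/-! ### The mean over the locations, with weights that depend on the nearest distance. -/

namespace SFR

open Filter Topology
open scoped ENNReal NNReal

variable {Ω : Type*} [MeasurableSpace Ω] {Pr : Measure Ω} {a b α ρ r lam k : ℝ}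
  {X : ℕ → Ω → Plane}

/-! ### The nearest station and the interference -/

/-- The distance of the nearest station. -/
noncomputable def nearestDist (X : ℕ → Ω → Plane) (ω : Ω) : ℝ :=
  ‖X (servingIdx fun n => X n ω) ω‖

lemma nearestDist_nonneg {Ω : Type*} (X : ℕ → Ω → Plane) (ω : Ω) : 0 ≤ nearestDist X ω :=
  norm_nonneg _

lemma IsPoissonProcess.measurable_nearestDist (hX : IsPoissonProcess Pr lam X) :
    Measurable (nearestDist X) := by
  have h : Measurable fun ω n => X n ω := measurable_pi_lambda _ hX.measurable
  have h2 := measurable_norm_servingIdx.comp h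
  exact h2

/-- Minus the logarithm of `survival`, summed over all stations. -/
noncomputable def totalLoss (X : ℕ → Ω → Plane) (a b α ρ : ℝ) (ω : Ω) : ℝ≥0∞ :=
  ∑' n, ENNReal.ofReal (-Real.log (survival a b α ρ ‖X n ω‖))

lemma IsPoissonProcess.measurable_totalLoss (hX : IsPoissonProcess Pr lam X) {f : Ω → ℝ}
    (hf : Measurable f) : Measurable fun ω => totalLoss X a b α (f ω) ω :=
  Measurable.tsum fun n => by
    have := hX.measurable n
    fun_prop

lemma expNeg_neg_log {q : ℝ} (h0 : 0 < q) (h1 : q ≤ 1) :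
    expNeg (ENNReal.ofReal (-Real.log q)) = ENNReal.ofReal q := by
  rw [expNeg_ofReal (by simpa using Real.log_nonpos h0.le h1), neg_neg, Real.exp_log h0]

lemma lintegral_Ioo_ofReal (hr : 0 ≤ r) :
    ∫⁻ y in Ioo 0 r, ENNReal.ofReal y = ENNReal.ofReal (r ^ 2 / 2) := by
  have h : IntegrableOn (fun y : ℝ => y) (Ioc 0 r) :=
    (intervalIntegrable_iff_integrableOn_Ioc_of_le hr).1 (continuous_id.intervalIntegrable 0 r)
  rw [setLIntegral_congr Ioo_ae_eq_Ioc, ← ofReal_integral_eq_lintegral_ofReal h,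
    ← intervalIntegral.integral_of_le hr, integral_id]
  · simp
  · exact (ae_restrict_iff' measurableSet_Ioc).2 (ae_of_all _ fun y hy => hy.1.le)

/-- The cost `⊤` inside the disc encodes that it contains no station: the disc contributes its full
area, the outside contributes `1 - survival`. -/
lemma lintegral_one_sub_expNeg (ha : 0 ≤ a) (hb : 0 ≤ b) (hα : 2 < α) (hρ : 0 ≤ ρ) (hr : 0 ≤ r) :
    ∫⁻ x : Plane, (1 - expNeg (if ‖x‖ < r then ⊤ else
        ENNReal.ofReal (-Real.log (survival a b α ρ ‖x‖))))
      = ENNReal.ofReal (Real.pi * voidExponent a b α ρ r) := by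
  have hmeas : Measurable fun y : ℝ => 1 - expNeg (if y < r then ⊤ else
      ENNReal.ofReal (-Real.log (survival a b α ρ y))) :=
    measurable_const.sub (measurable_expNeg.comp (Measurable.ite measurableSet_Iio
      measurable_const (by fun_prop)))
  rw [lintegral_fun_norm_plane hmeas]
  have hI := integrableOn_one_sub_survival_mul ha hb hα hρ hr
  have hnn : 0 ≤ᵐ[volume.restrict (Ioi r)] fun z => (1 - survival a b α ρ z) * z := by
    refine (ae_restrict_iff' measurableSet_Ioi).2 (ae_of_all _ fun z hz => ?_)
    have hz0 : 0 ≤ z := hr.trans (le_of_lt hz)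
    have h1 := survival_le_one (α := α) ha hb hρ hz0
    exact mul_nonneg (by linarith) hz0
  have h1 : ∫⁻ y in Ioo 0 r, ENNReal.ofReal y * (1 - expNeg (if y < r then ⊤ else
      ENNReal.ofReal (-Real.log (survival a b α ρ y)))) = ENNReal.ofReal (r ^ 2 / 2) := by
    rw [← lintegral_Ioo_ofReal hr]
    refine setLIntegral_congr_fun measurableSet_Ioo fun y hy => ?_
    simp [hy.2]
  have h2 : ∫⁻ y in Ioi r, ENNReal.ofReal y * (1 - expNeg (if y < r then ⊤ else
      ENNReal.ofReal (-Real.log (survival a b α ρ y))))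
      = ENNReal.ofReal (∫ z in Ioi r, (1 - survival a b α ρ z) * z) := by
    rw [ofReal_integral_eq_lintegral_ofReal hI hnn]
    refine setLIntegral_congr_fun measurableSet_Ioi fun y hy => ?_
    have hy0 : 0 ≤ y := hr.trans (le_of_lt hy)
    have hs1 := survival_le_one (α := α) ha hb hρ hy0
    have hs0 := survival_pos (α := α) ha hb hρ hy0
    have hyr : ¬ y < r := not_lt.2 (le_of_lt (mem_Ioi.1 hy))
    simp only [if_neg hyr]
    rw [expNeg_neg_log hs0 hs1, ← ENNReal.ofReal_one, ← ENNReal.ofReal_sub _ hs0.le,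
      ← ENNReal.ofReal_mul hy0, mul_comm]
  rw [← Ioc_union_Ioi_eq_Ioi hr, lintegral_union measurableSet_Ioi
    (Ioc_disjoint_Ioi le_rfl), ← setLIntegral_congr Ioo_ae_eq_Ioc, h1, h2,
    ← ENNReal.ofReal_add (by positivity) (integral_nonneg_of_ae hnn),
    ← ENNReal.ofReal_mul (by positivity), voidExponent]
  congr 1
  ring

/-- The Laplace transform of the interference on the event that no station is closer than `r`. -/
lemma setLIntegral_expNeg_totalLoss [IsProbabilityMeasure Pr] (hlam : 0 ≤ lam)
    (hX : IsPoissonProcess Pr lam X) (ha : 0 ≤ a) (hb : 0 ≤ b) (hα : 2 < α) (hρ : 0 ≤ ρ)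
    (hr : 0 ≤ r) :
    ∫⁻ ω in {ω | r ≤ nearestDist X ω}, expNeg (totalLoss X a b α ρ ω) ∂Pr
      = ENNReal.ofReal (Real.exp (-(Real.pi * lam * voidExponent a b α ρ r))) := by
  have hf : Measurable fun x : Plane => if ‖x‖ < r then ⊤ else
      ENNReal.ofReal (-Real.log (survival a b α ρ ‖x‖)) :=
    Measurable.ite (measurableSet_lt measurable_norm measurable_const) measurable_const
      (by fun_prop)
  have hv : 0 ≤ voidExponent a b α ρ r := (sq_nonneg r).trans (sq_le_voidExponent ha hb hρ hr)
  have h := lintegral_expNeg_tsum hlam hX hf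
  rw [lintegral_one_sub_expNeg ha hb hα hρ hr, ← ENNReal.ofReal_mul hlam,
    expNeg_ofReal (by positivity)] at h
  rw [← lintegral_indicator (measurableSet_le measurable_const hX.measurable_nearestDist),
    mul_comm Real.pi, mul_assoc, ← h]
  refine lintegral_congr_ae ?_
  filter_upwards [ae_finite_norm_le hlam hX] with ω hω
  by_cases hr' : r ≤ nearestDist X ω
  · rw [indicator_of_mem (by exact hr'), totalLoss]
    have hn : ∀ n, ¬ ‖X n ω‖ < r := fun n =>
      not_lt.2 (hr'.trans (norm_servingIdx_le hω n))
    simp only [hn, if_false]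
  · rw [indicator_of_notMem (by exact hr')]
    -- A station inside the disc makes the whole cost infinite, so the integrand vanishes off the
    -- event.
    have htop : ∑' n, (if ‖X n ω‖ < r then ⊤ else
        ENNReal.ofReal (-Real.log (survival a b α ρ ‖X n ω‖))) = (⊤ : ℝ≥0∞) := by
      refine ENNReal.tsum_eq_top_of_eq_top ⟨servingIdx fun n => X n ω, ?_⟩
      rw [if_pos]
      exact not_le.1 hr'
    rw [htop, expNeg_top]

/-- The difference of the formulas for the radii `r` and `r'`. The subtracted term is at most `1`,
so it can be cancelled. -/
lemma setLIntegral_expNeg_totalLoss_Ico [IsProbabilityMeasure Pr] (hlam : 0 ≤ lam)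
    (hX : IsPoissonProcess Pr lam X) (ha : 0 ≤ a) (hb : 0 ≤ b) (hα : 2 < α) (hρ : 0 ≤ ρ)
    (hr : 0 ≤ r) {r' : ℝ} (hr' : r ≤ r') :
    ∫⁻ ω in nearestDist X ⁻¹' (Ico r r'), expNeg (totalLoss X a b α ρ ω) ∂Pr
      = ∫⁻ y in Ico r r', ENNReal.ofReal (nearestDensity lam a b α ρ y) := by
  have hm : MeasurableSet {ω | r' ≤ nearestDist X ω} :=
    measurableSet_le measurable_const hX.measurable_nearestDist
  have h := setLIntegral_expNeg_totalLoss (α := α) hlam hX ha hb hα hρ hr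
  rw [ofReal_exp_voidExponent hlam ha hb hα hρ hr hr',
    ← setLIntegral_expNeg_totalLoss (α := α) hlam hX ha hb hα hρ (hr.trans hr'),
    ← lintegral_inter_add_sdiff _ {ω | r ≤ nearestDist X ω} hm, add_comm] at h
  have h1 : {ω | r ≤ nearestDist X ω} ∩ {ω | r' ≤ nearestDist X ω}
      = {ω | r' ≤ nearestDist X ω} := inter_eq_right.2 fun ω hω => hr'.trans hω
  have h2 : {ω | r ≤ nearestDist X ω} \ {ω | r' ≤ nearestDist X ω}
      = nearestDist X ⁻¹' (Ico r r') := by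
    ext ω; simp
  rw [h1, h2] at h
  refine (ENNReal.add_left_inj ?_).1 h
  refine ((lintegral_mono fun ω => expNeg_le_one _).trans_lt ?_).ne
  simp

/-! ### Discretization of the distance -/

/-- The largest multiple of `2^(-j)` below `y`. -/
noncomputable def dyadicFloor (j : ℕ) (y : ℝ) : ℝ := ⌊y * 2 ^ j⌋₊ / 2 ^ j

lemma dyadicFloor_nonneg (j : ℕ) (y : ℝ) : 0 ≤ dyadicFloor j y := by
  unfold dyadicFloor; positivity

lemma dyadicFloor_le (j : ℕ) {y : ℝ} (hy : 0 ≤ y) : dyadicFloor j y ≤ y := by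
  rw [dyadicFloor, div_le_iff₀ (by positivity)]
  exact Nat.floor_le (by positivity)

lemma monotone_dyadicFloor {y : ℝ} (hy : 0 ≤ y) : Monotone fun j => dyadicFloor j y := by
  refine monotone_nat_of_le_succ fun j => ?_
  unfold dyadicFloor
  rw [div_le_div_iff₀ (by positivity) (by positivity), pow_succ]
  have h : ((⌊y * 2 ^ j⌋₊ * 2 : ℕ) : ℝ) ≤ ⌊y * (2 ^ j * 2)⌋₊ := by
    refine Nat.cast_le.2 (Nat.le_floor ?_)
    push_cast
    have := Nat.floor_le (show 0 ≤ y * 2 ^ j by positivity)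
    linarith
  push_cast at h
  nlinarith [show (0 : ℝ) < 2 ^ j by positivity]

lemma tendsto_dyadicFloor {y : ℝ} (hy : 0 ≤ y) :
    Tendsto (fun j => dyadicFloor j y) atTop (𝓝 y) :=
  (tendsto_nat_floor_mul_div_atTop hy).comp (tendsto_pow_atTop_atTop_of_one_lt one_lt_two)

@[fun_prop] lemma measurable_dyadicFloor (j : ℕ) : Measurable (dyadicFloor j) := by
  have : Measurable fun y : ℝ => (⌊y * 2 ^ j⌋₊ : ℝ) :=
    measurable_from_nat.comp (Nat.measurable_floor.comp (measurable_id.mul_const _))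
  exact this.div_const _

/-- The intersection matters for `m = 0`, since the natural floor sends all negative numbers to `0`.
-/
lemma floor_preimage_inter_Ici (j m : ℕ) :
    {y : ℝ | ⌊y * 2 ^ j⌋₊ = m} ∩ Ici 0 = Ico ((m : ℝ) / 2 ^ j) ((m + 1) / 2 ^ j) := by
  ext y
  have h2 : (0 : ℝ) < 2 ^ j := by positivity
  rw [mem_Ico, div_le_iff₀ h2, lt_div_iff₀ h2]
  constructor
  · rintro ⟨h, h0 : 0 ≤ y⟩
    exact (Nat.floor_eq_iff (by positivity)).1 h
  · intro h
    have h0 : 0 ≤ y := by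
      have : 0 ≤ y * 2 ^ j := (Nat.cast_nonneg m).trans h.1
      exact nonneg_of_mul_nonneg_left this h2
    exact ⟨(Nat.floor_eq_iff (by positivity)).2 h, h0⟩

lemma lintegral_eq_tsum_fiber {β : Type*} [MeasurableSpace β] {ν : Measure β} {N : β → ℕ}
    (hN : Measurable N) (f : β → ℝ≥0∞) :
    ∫⁻ x, f x ∂ν = ∑' m, ∫⁻ x in N ⁻¹' {m}, f x ∂ν := by
  rw [← lintegral_iUnion (fun m => hN (measurableSet_singleton m))
    (fun i j hij => (disjoint_singleton.2 hij).preimage N), ← preimage_iUnion,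
    iUnion_of_singleton, preimage_univ, setLIntegral_univ]

/-- On each dyadic interval the rounded distance is a constant, so the formula for a frozen distance
applies there; the pieces are then summed. -/
lemma lintegral_dyadicFloor [IsProbabilityMeasure Pr] (hlam : 0 ≤ lam)
    (hX : IsPoissonProcess Pr lam X) (ha : 0 ≤ a) (hb : 0 ≤ b) (hα : 2 < α) (j : ℕ) :
    ∫⁻ ω, expNeg (ENNReal.ofReal (k * dyadicFloor j (nearestDist X ω) ^ α))
        * expNeg (totalLoss X a b α (dyadicFloor j (nearestDist X ω)) ω) ∂Pr
      = ∫⁻ y in Ici 0, expNeg (ENNReal.ofReal (k * dyadicFloor j y ^ α))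
        * ENNReal.ofReal (nearestDensity lam a b α (dyadicFloor j y) y) := by
  have hfl : Measurable fun y : ℝ => ⌊y * 2 ^ j⌋₊ :=
    Nat.measurable_floor.comp (measurable_id.mul_const _)
  rw [lintegral_eq_tsum_fiber (hfl.comp hX.measurable_nearestDist),
    lintegral_eq_tsum_fiber hfl]
  congr 1 with m
  have hpre : (fun ω => ⌊nearestDist X ω * 2 ^ j⌋₊) ⁻¹' {m}
      = nearestDist X ⁻¹' (Ico ((m : ℝ) / 2 ^ j) ((m + 1) / 2 ^ j)) := by
    rw [← floor_preimage_inter_Ici]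
    ext ω
    simp [nearestDist_nonneg]
  have hmf : MeasurableSet ((fun y : ℝ => ⌊y * 2 ^ j⌋₊) ⁻¹' {m}) :=
    hfl (measurableSet_singleton m)
  have hle : (m : ℝ) / 2 ^ j ≤ (m + 1) / 2 ^ j := by gcongr; linarith
  have hρ : (0 : ℝ) ≤ m / 2 ^ j := by positivity
  have hL : ∫⁻ ω in (fun ω => ⌊nearestDist X ω * 2 ^ j⌋₊) ⁻¹' {m},
      expNeg (ENNReal.ofReal (k * dyadicFloor j (nearestDist X ω) ^ α))
        * expNeg (totalLoss X a b α (dyadicFloor j (nearestDist X ω)) ω) ∂Pr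
      = ∫⁻ ω in (fun ω => ⌊nearestDist X ω * 2 ^ j⌋₊) ⁻¹' {m},
      expNeg (ENNReal.ofReal (k * ((m : ℝ) / 2 ^ j) ^ α))
        * expNeg (totalLoss X a b α ((m : ℝ) / 2 ^ j) ω) ∂Pr := by
    refine setLIntegral_congr_fun
      ((hfl.comp hX.measurable_nearestDist) (measurableSet_singleton m)) fun ω hω => ?_
    have : ⌊nearestDist X ω * 2 ^ j⌋₊ = m := hω
    simp only [dyadicFloor, this]
  have hR : ∫⁻ y in (fun y : ℝ => ⌊y * 2 ^ j⌋₊) ⁻¹' {m},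
      expNeg (ENNReal.ofReal (k * dyadicFloor j y ^ α))
        * ENNReal.ofReal (nearestDensity lam a b α (dyadicFloor j y) y) ∂(volume.restrict (Ici 0))
      = ∫⁻ y in (fun y : ℝ => ⌊y * 2 ^ j⌋₊) ⁻¹' {m},
      expNeg (ENNReal.ofReal (k * ((m : ℝ) / 2 ^ j) ^ α))
        * ENNReal.ofReal (nearestDensity lam a b α ((m : ℝ) / 2 ^ j) y)
          ∂(volume.restrict (Ici 0)) := by
    refine setLIntegral_congr_fun hmf fun y hy => ?_
    have : ⌊y * 2 ^ j⌋₊ = m := hy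
    simp only [dyadicFloor, this]
  have hset : (fun y : ℝ => ⌊y * 2 ^ j⌋₊) ⁻¹' {m} ∩ Ici 0
      = Ico ((m : ℝ) / 2 ^ j) ((m + 1) / 2 ^ j) := floor_preimage_inter_Ici j m
  refine hL.trans (Eq.trans ?_ hR.symm)
  rw [lintegral_const_mul' _ _ (expNeg_ne_top _), lintegral_const_mul' _ _ (expNeg_ne_top _),
    Measure.restrict_restrict hmf, hset, hpre,
    setLIntegral_expNeg_totalLoss_Ico hlam hX ha hb hα hρ hρ hle]

/-- The bound does not depend on `ρ` and serves as the dominating function when the dyadic mesh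
shrinks. -/
lemma nearestDensity_le (hlam : 0 ≤ lam) (ha : 0 ≤ a) (hb : 0 ≤ b) (hρ : 0 ≤ ρ) {y : ℝ}
    (hy : 0 ≤ y) :
    nearestDensity lam a b α ρ y
      ≤ 2 * Real.pi * lam * (y * Real.exp (-(Real.pi * lam) * y ^ 2)) := by
  have h1 := survival_le_one (α := α) ha hb hρ hy
  have h2 := sq_le_voidExponent (α := α) ha hb hρ hy
  have h0 := survival_pos (α := α) ha hb hρ hy
  have h3 : Real.exp (-(Real.pi * lam * voidExponent a b α ρ y))
      ≤ Real.exp (-(Real.pi * lam) * y ^ 2) := by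
    rw [Real.exp_le_exp, neg_mul, neg_le_neg_iff]
    gcongr
  unfold nearestDensity
  calc _ ≤ 2 * Real.pi * lam * y * 1 * Real.exp (-(Real.pi * lam) * y ^ 2) := by gcongr
    _ = _ := by ring

lemma tendsto_totalLoss (ha : 0 ≤ a) (hb : 0 ≤ b) (hα : 0 < α) (hρ : 0 ≤ ρ) {u : ℕ → ℝ}
    (hu0 : ∀ j, 0 ≤ u j) (hu : Monotone u) (hlim : Tendsto u atTop (𝓝 ρ)) {Ω : Type*}
    (X : ℕ → Ω → Plane) (ω : Ω) :
    Tendsto (fun j => totalLoss X a b α (u j) ω) atTop (𝓝 (totalLoss X a b α ρ ω)) := by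
  refine tendsto_tsum_of_monotone (fun n i j hij => ?_) fun n => ?_
  · have h := survival_antitone ha hb hα.le (hu0 i) (norm_nonneg (X n ω)) (hu hij)
    have h0 := survival_pos (α := α) ha hb (hu0 j) (norm_nonneg (X n ω))
    exact ENNReal.ofReal_le_ofReal (neg_le_neg (Real.log_le_log h0 h))
  · have h0 := survival_pos (α := α) ha hb hρ (norm_nonneg (X n ω))
    have hc := (continuousAt_survival_left ha hb hα hρ (norm_nonneg (X n ω))).tendsto.comp hlim
    exact (ENNReal.continuous_ofReal.tendsto _).comp
      (((Real.continuousAt_log h0.ne').tendsto.comp hc).neg)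

/-- The Laplace transform of the interference, when its weights depend on the distance of the
nearest station. -/
theorem lintegral_expNeg_totalLoss_nearestDist [IsProbabilityMeasure Pr] (hlam : 0 < lam)
    (hX : IsPoissonProcess Pr lam X) (ha : 0 ≤ a) (hb : 0 ≤ b) (hα : 2 < α) :
    ∫⁻ ω, expNeg (ENNReal.ofReal (k * nearestDist X ω ^ α))
        * expNeg (totalLoss X a b α (nearestDist X ω) ω) ∂Pr
      = ∫⁻ y in Ici 0, expNeg (ENNReal.ofReal (k * y ^ α))
        * ENNReal.ofReal (nearestDensity lam a b α y y) := by
  have hα0 : 0 < α := by linarith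
  have hRm := hX.measurable_nearestDist
  have hpow : ∀ y : ℝ, 0 ≤ y → Tendsto
      (fun j => expNeg (ENNReal.ofReal (k * dyadicFloor j y ^ α))) atTop
      (𝓝 (expNeg (ENNReal.ofReal (k * y ^ α)))) := by
    intro y hy
    have hc : Continuous fun y : ℝ => expNeg (ENNReal.ofReal (k * y ^ α)) :=
      continuous_expNeg.comp (ENNReal.continuous_ofReal.comp
        ((Real.continuous_rpow_const hα0.le).const_mul k))
    exact (hc.tendsto y).comp (tendsto_dyadicFloor hy)
  have hL : Tendsto (fun j => ∫⁻ ω, expNeg (ENNReal.ofReal (k * dyadicFloor j (nearestDist X ω) ^ α))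
        * expNeg (totalLoss X a b α (dyadicFloor j (nearestDist X ω)) ω) ∂Pr) atTop
      (𝓝 (∫⁻ ω, expNeg (ENNReal.ofReal (k * nearestDist X ω ^ α))
        * expNeg (totalLoss X a b α (nearestDist X ω) ω) ∂Pr)) := by
    refine tendsto_lintegral_of_dominated_convergence (fun _ => 1) (fun j => ?_)
      (fun j => ae_of_all _ fun ω => ?_) (by simp) (ae_of_all _ fun ω => ?_)
    · have h1 : Measurable fun ω => dyadicFloor j (nearestDist X ω) :=
        (measurable_dyadicFloor j).comp hRm
      have h2 := hX.measurable_totalLoss (a := a) (b := b) (α := α) h1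
      fun_prop
    · exact mul_le_one' (expNeg_le_one _) (expNeg_le_one _)
    · have hR0 := nearestDist_nonneg X ω
      refine ENNReal.Tendsto.mul (hpow _ hR0) (Or.inr (expNeg_ne_top _))
        ((continuous_expNeg.tendsto _).comp (tendsto_totalLoss ha hb hα0 hR0
          (fun j => dyadicFloor_nonneg j _) (monotone_dyadicFloor hR0) (tendsto_dyadicFloor hR0) X ω))
        (Or.inr (expNeg_ne_top _))
  have hbound : Integrable fun y : ℝ =>
      2 * Real.pi * lam * (y * Real.exp (-(Real.pi * lam) * y ^ 2)) :=
    (integrable_mul_exp_neg_mul_sq (by positivity)).const_mul _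
  have hRhs : Tendsto (fun j => ∫⁻ y in Ici 0, expNeg (ENNReal.ofReal (k * dyadicFloor j y ^ α))
        * ENNReal.ofReal (nearestDensity lam a b α (dyadicFloor j y) y)) atTop
      (𝓝 (∫⁻ y in Ici 0, expNeg (ENNReal.ofReal (k * y ^ α))
        * ENNReal.ofReal (nearestDensity lam a b α y y))) := by
    refine tendsto_lintegral_of_dominated_convergence
      (fun y => ENNReal.ofReal (2 * Real.pi * lam * (y * Real.exp (-(Real.pi * lam) * y ^ 2))))
      (fun j => ?_)
      (fun j => (ae_restrict_iff' measurableSet_Ici).2 (ae_of_all _ fun y (hy : 0 ≤ y) => ?_))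
      (hbound.restrict (s := Ici 0)).lintegral_lt_top.ne
      ((ae_restrict_iff' measurableSet_Ici).2 (ae_of_all _ fun y (hy : 0 ≤ y) => ?_))
    · have h := measurable_nearestDensity (lam := lam) (a := a) (b := b) (α := α)
        (measurable_dyadicFloor j) measurable_id
      simp only [id] at h
      fun_prop
    · calc _ ≤ 1 * ENNReal.ofReal (2 * Real.pi * lam * (y * Real.exp (-(Real.pi * lam) * y ^ 2))) :=
            mul_le_mul' (expNeg_le_one _) (ENNReal.ofReal_le_ofReal
              (nearestDensity_le hlam.le ha hb (dyadicFloor_nonneg j y) hy))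
        _ = _ := one_mul _
    · refine ENNReal.Tendsto.mul (hpow y hy) (Or.inr ENNReal.ofReal_ne_top)
        ((ENNReal.continuous_ofReal.tendsto _).comp ?_) (Or.inr (expNeg_ne_top _))
      have hv := tendsto_voidExponent ha hb hα hy hy (fun j => dyadicFloor_nonneg j y)
        (fun j => dyadicFloor_le j hy) (tendsto_dyadicFloor hy)
      have hs := (continuousAt_survival_left ha hb hα0 hy hy).tendsto.comp (tendsto_dyadicFloor hy)
      exact (hs.const_mul _).mul ((Real.continuous_exp.tendsto _).comp (hv.const_mul _).neg)
  -- Both sides agree at every dyadic level, hence so do their limits.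
  refine tendsto_nhds_unique hL (hRhs.congr fun j => ?_)
  exact (lintegral_dyadicFloor hlam.le hX ha hb hα j).symm

end SFR

namespace SFR

open Filter Topology
open scoped ENNReal NNReal

/-! ### The joint coverage probability -/

section Formulas

variable {a b α lam μ P noise : ℝ}

lemma xi_nonneg (ha : 0 ≤ a) (hb : 0 ≤ b) : 0 ≤ xi a b α := by
  refine setIntegral_nonneg measurableSet_Ioi fun x hx => ?_
  have hx0 : (0 : ℝ) < x := one_pos.trans hx
  have h : 0 ≤ x ^ (-α) := by positivity
  refine mul_nonneg (sub_nonneg.2 (mul_le_one₀ ?_ (by positivity) ?_)) hx0.le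
  · rw [div_le_one (by positivity)]; nlinarith [mul_nonneg hb h]
  · rw [div_le_one (by positivity)]; nlinarith [mul_nonneg ha h]

lemma integrableOn_jointCoverage (hlam : 0 < lam) (hμ : 0 ≤ μ) (hP : 0 ≤ P) (hn : 0 ≤ noise)
    (ha : 0 ≤ a) (hb : 0 ≤ b) :
    IntegrableOn (fun v => Real.exp (-(Real.pi * lam * v * (1 + 2 * xi a b α))
      - μ * (a + b) * (noise / P) * v ^ (α / 2))) (Ioi 0) := by
  have hxi := xi_nonneg (α := α) ha hb
  refine Integrable.mono' (exp_neg_integrableOn_Ioi 0 (b := Real.pi * lam) (by positivity))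
    (by fun_prop) ((ae_restrict_iff' measurableSet_Ioi).2 (ae_of_all _ fun v hv => ?_))
  have hv0 : 0 < v := hv
  rw [Real.norm_of_nonneg (by positivity), Real.exp_le_exp]
  have h1 : 0 ≤ μ * (a + b) * (noise / P) * v ^ (α / 2) := by positivity
  have h2 : 0 ≤ Real.pi * lam * v * (2 * xi a b α) := by positivity
  linarith

/-- Substitute `v = y²`, which makes the distance the variable. -/
lemma ofReal_jointCoverage (hlam : 0 < lam) (hμ : 0 ≤ μ) (hP : 0 ≤ P) (hn : 0 ≤ noise)
    (ha : 0 ≤ a) (hb : 0 ≤ b) :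
    ENNReal.ofReal (jointCoverage μ P noise a b lam α)
      = ∫⁻ y in Ioi 0, ENNReal.ofReal (2 * Real.pi * lam * y
        * Real.exp (-(Real.pi * lam * y ^ 2 * (1 + 2 * xi a b α))
          - μ * (a + b) * (noise / P) * y ^ α)) := by
  set f : ℝ → ℝ := fun v => Real.exp (-(Real.pi * lam * v * (1 + 2 * xi a b α))
      - μ * (a + b) * (noise / P) * v ^ (α / 2)) with hf
  have hI : IntegrableOn f (Ioi 0) := integrableOn_jointCoverage hlam hμ hP hn ha hb
  have hI2 : IntegrableOn (fun y : ℝ => (2 * y ^ ((2 : ℝ) - 1)) • f (y ^ (2 : ℝ))) (Ioi 0) := by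
    have := (integrableOn_Ioi_comp_rpow_iff f (two_ne_zero (α := ℝ))).2 hI
    simpa using this
  have hpt : ∀ y ∈ Ioi (0 : ℝ), Real.pi * lam * ((2 * y ^ ((2 : ℝ) - 1)) • f (y ^ (2 : ℝ)))
      = 2 * Real.pi * lam * y * Real.exp (-(Real.pi * lam * y ^ 2 * (1 + 2 * xi a b α))
          - μ * (a + b) * (noise / P) * y ^ α) := by
    intro y hy
    have hy0 : 0 < y := hy
    have h1 : y ^ ((2 : ℝ) - 1) = y := by norm_num
    have h2 : (y ^ 2) ^ (α / 2) = y ^ α := by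
      rw [← Real.rpow_two, ← Real.rpow_mul hy0.le]; congr 1; ring
    simp only [hf, h1, Real.rpow_two, h2, smul_eq_mul]
    ring
  rw [jointCoverage, ← integral_comp_rpow_Ioi_of_pos (g := f) two_pos, ← integral_const_mul,
    ofReal_integral_eq_lintegral_ofReal (hI2.const_mul _)]
  · exact setLIntegral_congr_fun measurableSet_Ioi fun y hy => by simp only [hpt y hy]
  · refine (ae_restrict_iff' measurableSet_Ioi).2 (ae_of_all _ fun y hy => ?_)
    have hy0 : 0 < y := hy
    refine le_of_le_of_eq ?_ (hpt y hy).symm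
    simp only [Pi.zero_apply]
    positivity

lemma jointCoverage_nonneg (hlam : 0 ≤ lam) : 0 ≤ jointCoverage μ P noise a b lam α :=
  mul_nonneg (by positivity) (integral_nonneg fun v => (Real.exp_pos _).le)

end Formulas

variable {Ω : Type*} [MeasurableSpace Ω] {Pr : Measure Ω} {a b c d α lam μ P noise : ℝ}
  {X : ℕ → Ω → Plane} {g gNew : ℕ → Ω → ℝ}

lemma survival_self {y : ℝ} (hy : 0 < y) :
    survival a b α y y = 1 / (1 + b) * (1 / (1 + a)) := by
  simp [survival, div_self hy.ne']

/-- `totalLoss` runs over all stations, whereas the interference omits the serving one. For that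
station the distance ratio is `1`, so its factor is the constant `1 / ((1 + a) (1 + b))`, multiplied
in here. -/
lemma condCover_mul (hμ : 0 ≤ μ) (ha : 0 ≤ a) (hb : 0 ≤ b) (hc : 0 ≤ c) (hd : 0 ≤ d) {Ω : Type*}
    (X : ℕ → Ω → Plane) (ω : Ω) (hR : 0 < nearestDist X ω) :
    condCover μ a c α (fun n => X n ω) * condCover μ b d α (fun n => X n ω)
        * ENNReal.ofReal (1 / (1 + b) * (1 / (1 + a)))
      = expNeg (ENNReal.ofReal (μ * (c + d) * nearestDist X ω ^ α))
        * expNeg (totalLoss X a b α (nearestDist X ω) ω) := by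
  classical
  have hs0 := survival_pos (α := α) ha hb hR.le hR.le
  have hs1 := survival_le_one (α := α) ha hb hR.le hR.le
  have hk : ENNReal.ofReal (μ * (c + d) * nearestDist X ω ^ α)
      = ENNReal.ofReal μ * ENNReal.ofReal (c * nearestDist X ω ^ α)
        + ENNReal.ofReal μ * ENNReal.ofReal (d * nearestDist X ω ^ α) := by
    rw [← ENNReal.ofReal_mul hμ, ← ENNReal.ofReal_mul hμ,
      ← ENNReal.ofReal_add (by positivity) (by positivity)]
    congr 1
    ring
  have ht : totalLoss X a b α (nearestDist X ω) ω
      = ENNReal.ofReal (-Real.log (1 / (1 + b) * (1 / (1 + a))))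
        + (∑' n, ENNReal.ofReal (Real.log (1 + interfWeight a α (fun n => X n ω) n))
        + ∑' n, ENNReal.ofReal (Real.log (1 + interfWeight b α (fun n => X n ω) n))) := by
    rw [totalLoss, ENNReal.tsum_eq_add_tsum_ite (servingIdx fun n => X n ω), ← ENNReal.tsum_add,
      ← survival_self (α := α) hR]
    congr 2
    ext n
    by_cases hn : n = servingIdx fun n => X n ω
    · simp [hn, interfWeight]
    · have hA : 0 ≤ a * (nearestDist X ω / ‖X n ω‖) ^ α := by positivity
      have hB : 0 ≤ b * (nearestDist X ω / ‖X n ω‖) ^ α := by positivity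
      have h1 : interfWeight a α (fun n => X n ω) n = a * (nearestDist X ω / ‖X n ω‖) ^ α := if_neg hn
      have h2 : interfWeight b α (fun n => X n ω) n = b * (nearestDist X ω / ‖X n ω‖) ^ α := if_neg hn
      rw [if_neg hn, h1, h2, ← ENNReal.ofReal_add (Real.log_nonneg (by linarith))
        (Real.log_nonneg (by linarith)), survival, Real.log_mul (by positivity) (by positivity),
        Real.log_div (by positivity) (by positivity), Real.log_div (by positivity) (by positivity),
        Real.log_one]
      congr 1
      ring
  rw [survival_self hR] at hs0 hs1
  rw [hk, ht, condCover, condCover]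
  simp only [expNeg_add]
  rw [expNeg_neg_log hs0 hs1]
  simp only [nearestDist]
  ring

/-- The probability that the signals on both sub-bands dominate noise plus interference. -/
theorem IsNetwork.measure_cover_inter_eq_jointCoverage (hnet : IsNetwork Pr lam μ X g gNew)
    (hlam : 0 < lam) (hμ : 0 < μ) (hα : 2 < α) (hP : 0 < P) (hn : 0 ≤ noise) (ha : 0 ≤ a)
    (hb : 0 ≤ b) :
    Pr ({ω | (fun n => X n ω, fun n => gNew n ω) ∈ coverSet a (a * (noise / P)) α}
        ∩ {ω | (fun n => X n ω, fun n => g n ω) ∈ coverSet b (b * (noise / P)) α})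
      = ENNReal.ofReal (jointCoverage μ P noise a b lam α) := by
  have := hnet.indep_fading.isProbabilityMeasure
  have hq : 0 < 1 / (1 + b) * (1 / (1 + a)) := by positivity
  have hR : ∀ᵐ ω ∂Pr, 0 < nearestDist X ω := by
    filter_upwards [ae_ne_zero hlam.le hnet.poisson] with ω hω
    exact norm_pos_iff.2 (hω _)
  rw [hnet.measure_cover_inter hμ ha hb]
  have hq' : ENNReal.ofReal (1 / (1 + b) * (1 / (1 + a))) ≠ 0 := by
    simpa using hq
  -- Both sides are multiplied by the factor of the serving station; on the other side it reappears
  -- as the `survival` factor in `nearestDensity`.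
  refine (ENNReal.mul_left_inj hq' ENNReal.ofReal_ne_top).1 ?_
  rw [← lintegral_mul_const' _ _ ENNReal.ofReal_ne_top]
  calc _ = ∫⁻ ω, expNeg (ENNReal.ofReal (μ * (a * (noise / P) + b * (noise / P))
            * nearestDist X ω ^ α)) * expNeg (totalLoss X a b α (nearestDist X ω) ω) ∂Pr := by
        refine lintegral_congr_ae ?_
        filter_upwards [hR] with ω hω
        exact condCover_mul hμ.le ha hb (by positivity) (by positivity) X ω hω
    _ = ∫⁻ y in Ioi 0, ENNReal.ofReal (2 * Real.pi * lam * y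
        * Real.exp (-(Real.pi * lam * y ^ 2 * (1 + 2 * xi a b α))
          - μ * (a + b) * (noise / P) * y ^ α)) * ENNReal.ofReal (1 / (1 + b) * (1 / (1 + a))) := by
        rw [lintegral_expNeg_totalLoss_nearestDist hlam hnet.poisson ha hb hα,
          setLIntegral_congr Ioi_ae_eq_Ici.symm]
        refine setLIntegral_congr_fun measurableSet_Ioi fun y hy => ?_
        have hy0 : 0 < y := hy
        rw [expNeg_ofReal (by positivity), ← ENNReal.ofReal_mul (by positivity),
          ← ENNReal.ofReal_mul (by positivity), nearestDensity, survival_self hy0,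
          voidExponent_self hy0, sub_eq_add_neg, Real.exp_add]
        congr 1
        ring_nf
    _ = _ := by
        rw [lintegral_mul_const' _ _ ENNReal.ofReal_ne_top,
          ofReal_jointCoverage hlam hμ.le hP.le hn ha hb]

end SFR

namespace SFR

open Filter Topology
open scoped ENNReal NNReal

/-! ### The coverage probability -/

section Coverage

variable {a b T α lam μ P noise : ℝ}

lemma xi_comm : xi a b α = xi b a α := by
  simp only [xi, mul_comm (1 / (1 + b * _))]

lemma jointCoverage_comm : jointCoverage μ P noise a b lam α = jointCoverage μ P noise b a lam α := by
  simp only [jointCoverage, xi_comm (a := a), add_comm a]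

/-- Substitute `u = T^(-2/α) x²`, which moves the lower limit to `1`; the factor `2` comes from
`du`. -/
lemma rho_eq_two_mul_xi (hα : 0 < α) (hT : 0 < T) : rho T α = 2 * xi T 0 α := by
  have hc : 0 < T ^ (-2 / α) := by positivity
  have hTc : T ^ (2 / α) * T ^ (-2 / α) = 1 := by
    rw [← Real.rpow_add hT, neg_div, add_neg_cancel, Real.rpow_zero]
  have h1 := integral_comp_mul_left_Ioi' (fun u : ℝ => 1 / (1 + u ^ (α / 2))) 1 hc
  rw [mul_one, smul_eq_mul] at h1
  have h2 := integral_comp_rpow_Ioi_of_pos' (g := fun v : ℝ => 1 / (1 + (T ^ (-2 / α) * v) ^ (α / 2)))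
    (two_pos (α := ℝ)) (zero_le_one (α := ℝ))
  rw [Real.one_rpow] at h2
  rw [rho, ← h1, ← mul_assoc, hTc, one_mul, ← h2, xi, ← integral_const_mul]
  refine setIntegral_congr_fun measurableSet_Ioi fun x hx => ?_
  have hx0 : (0 : ℝ) < x := one_pos.trans hx
  have h3 : (T ^ (-2 / α) * x ^ (2 : ℝ)) ^ (α / 2) = T⁻¹ * x ^ α := by
    rw [Real.mul_rpow hc.le (by positivity), ← Real.rpow_mul hT.le, ← Real.rpow_mul hx0.le,
      show -2 / α * (α / 2) = -1 by field_simp, show 2 * (α / 2) = α by ring, Real.rpow_neg_one]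
  have h4 : x ^ ((2 : ℝ) - 1) = x := by norm_num
  have h5 : 0 < x ^ α := by positivity
  simp only [h3, h4, Real.rpow_neg hx0.le, smul_eq_mul]
  field_simp
  ring

lemma coverage_eq_jointCoverage (hα : 0 < α) (hT : 0 < T) :
    coverage μ P noise T lam α 1 = jointCoverage μ P noise T 0 lam α := by
  simp only [coverage, jointCoverage, rho_eq_two_mul_xi hα hT, add_zero, div_one, one_mul]

lemma integrableOn_one_div_one_add_rpow (hα : 2 < α) {c : ℝ} (hc : 0 < c) :
    IntegrableOn (fun u : ℝ => 1 / (1 + u ^ (α / 2))) (Ioi c) := by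
  refine Integrable.mono' (integrableOn_Ioi_rpow_of_lt (a := -(α / 2)) (by linarith) hc)
    (by fun_prop : Measurable fun u : ℝ => 1 / (1 + u ^ (α / 2))).aestronglyMeasurable
    ((ae_restrict_iff' measurableSet_Ioi).2 (ae_of_all _ fun u hu => ?_))
  have hu0 : 0 < u := hc.trans hu
  have h : 0 < u ^ (α / 2) := by positivity
  rw [Real.norm_of_nonneg (by positivity), Real.rpow_neg hu0.le, ← one_div]
  gcongr
  linarith

lemma integral_one_div_one_add_rpow_pos (hα : 2 < α) {c : ℝ} (hc : 0 < c) :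
    0 < ∫ u in Ioi c, 1 / (1 + u ^ (α / 2)) := by
  rw [setIntegral_pos_iff_support_of_nonneg_ae _ (integrableOn_one_div_one_add_rpow hα hc)]
  · have : Ioi c ⊆ Function.support fun u : ℝ => 1 / (1 + u ^ (α / 2)) := by
      intro u hu
      have hu0 : 0 < u := hc.trans hu
      have h : 0 < u ^ (α / 2) := by positivity
      simp only [Function.mem_support]
      positivity
    rw [inter_eq_right.2 this]
    simp
  · refine (ae_restrict_iff' measurableSet_Ioi).2 (ae_of_all _ fun u hu => ?_)
    have hu0 : 0 < u := hc.trans hu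
    simp only [Pi.zero_apply]
    positivity

lemma rho_pos (hα : 2 < α) (hT : 0 < T) : 0 < rho T α :=
  mul_pos (by positivity) (integral_one_div_one_add_rpow_pos hα (by positivity))

/-- For `T ≥ 1` the lower limit is at most `1`. This gives the growth rate `T^(2/α)` that makes the
rate integral converge. -/
lemma rpow_mul_le_rho (hα : 2 < α) (hT : 1 ≤ T) :
    T ^ (2 / α) * ∫ u in Ioi (1 : ℝ), 1 / (1 + u ^ (α / 2)) ≤ rho T α := by
  have hc : 0 < T ^ (-2 / α) := by positivity
  have hc1 : T ^ (-2 / α) ≤ 1 := Real.rpow_le_one_of_one_le_of_nonpos hT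
    (div_nonpos_of_nonpos_of_nonneg (by norm_num) (by linarith))
  unfold rho
  refine mul_le_mul_of_nonneg_left (setIntegral_mono_set
    (integrableOn_one_div_one_add_rpow hα hc) ?_ (Ioi_subset_Ioi hc1).eventuallyLE) (by positivity)
  refine (ae_restrict_iff' measurableSet_Ioi).2 (ae_of_all _ fun u hu => ?_)
  have hu0 : 0 < u := hc.trans hu
  simp only [Pi.zero_apply]
  positivity

/-- Dropping the noise term leaves an explicit exponential integral. -/
lemma jointCoverage_le (hlam : 0 < lam) (hμ : 0 ≤ μ) (hP : 0 ≤ P) (hn : 0 ≤ noise)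
    (ha : 0 ≤ a) (hb : 0 ≤ b) :
    jointCoverage μ P noise a b lam α ≤ (1 + 2 * xi a b α)⁻¹ := by
  have hxi := xi_nonneg (α := α) ha hb
  set κ := Real.pi * lam * (1 + 2 * xi a b α) with hκ
  have hκ0 : 0 < κ := by positivity
  have h : ∫ v in Ioi (0 : ℝ), Real.exp (-(Real.pi * lam * v * (1 + 2 * xi a b α))
      - μ * (a + b) * (noise / P) * v ^ (α / 2)) ≤ ∫ v in Ioi (0 : ℝ), Real.exp (-κ * v) := by
    refine setIntegral_mono_on (integrableOn_jointCoverage hlam hμ hP hn ha hb)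
      (exp_neg_integrableOn_Ioi 0 hκ0) measurableSet_Ioi fun v hv => ?_
    have hv0 : 0 < v := hv
    have h1 : 0 ≤ μ * (a + b) * (noise / P) * v ^ (α / 2) := by positivity
    rw [Real.exp_le_exp, hκ]
    nlinarith
  have h2 : ∫ v in Ioi (0 : ℝ), Real.exp (-κ * v) = κ⁻¹ := by
    have := integral_exp_mul_Ioi (neg_lt_zero.2 hκ0) 0
    rw [this]; simp
  rw [h2] at h
  calc jointCoverage μ P noise a b lam α ≤ Real.pi * lam * κ⁻¹ := by
        unfold jointCoverage; gcongr
    _ = _ := by rw [hκ]; field_simp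

lemma coverage_le (hlam : 0 < lam) (hμ : 0 ≤ μ) (hP : 0 ≤ P) (hn : 0 ≤ noise) (hα : 2 < α)
    (hT : 0 < T) : coverage μ P noise T lam α 1 ≤ (1 + rho T α)⁻¹ := by
  rw [coverage_eq_jointCoverage (by linarith) hT, rho_eq_two_mul_xi (by linarith) hT]
  exact jointCoverage_le hlam hμ hP hn hT.le le_rfl

lemma coverage_lt_one (hlam : 0 < lam) (hμ : 0 ≤ μ) (hP : 0 ≤ P) (hn : 0 ≤ noise) (hα : 2 < α)
    (hT : 0 < T) : coverage μ P noise T lam α 1 < 1 :=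
  (coverage_le hlam hμ hP hn hα hT).trans_lt
    (inv_lt_one_of_one_lt₀ (by linarith [rho_pos hα hT]))

lemma lintegral_coverage_lt_top (hlam : 0 < lam) (hμ : 0 ≤ μ) (hP : 0 ≤ P) (hn : 0 ≤ noise)
    (hα : 2 < α) {κ : ℝ} (hκ : 0 < κ) :
    ∫⁻ t in Ioi 0, ENNReal.ofReal (coverage μ P noise (κ * (Real.exp t - 1)) lam α 1) < ⊤ := by
  set K := ∫ u in Ioi (1 : ℝ), 1 / (1 + u ^ (α / 2)) with hK
  have hK0 : 0 < K := integral_one_div_one_add_rpow_pos hα one_pos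
  -- Beyond `t₀` both `e^t - 1 ≥ e^t / 2` and `κ e^t / 2 ≥ 1` hold. Up to `t₀` the bound `1` is
  -- enough.
  set t₀ := max (Real.log 2) (Real.log (2 / κ)) with ht₀
  have ht₀0 : 0 ≤ t₀ := le_max_of_le_left (Real.log_nonneg (by norm_num))
  rw [← Ioc_union_Ioi_eq_Ioi ht₀0, lintegral_union measurableSet_Ioi (Ioc_disjoint_Ioi le_rfl)]
  have hpos : ∀ t, 0 < t → 0 < κ * (Real.exp t - 1) := fun t ht =>
    mul_pos hκ (by linarith [Real.add_one_lt_exp ht.ne'])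
  refine ENNReal.add_lt_top.2 ⟨?_, ?_⟩
  · refine (setLIntegral_mono' (g := fun _ => 1) measurableSet_Ioc fun t ht => ?_).trans_lt
      (by simp)
    exact ENNReal.ofReal_le_one.2 (coverage_lt_one hlam hμ hP hn hα (hpos t ht.1)).le
  · have hg : IntegrableOn (fun t : ℝ => K⁻¹ * (κ / 2) ^ (-(2 / α)) * Real.exp (-(2 / α) * t))
        (Ioi t₀) := (exp_neg_integrableOn_Ioi t₀ (by positivity)).const_mul _
    refine (setLIntegral_mono' measurableSet_Ioi fun t ht => ?_).trans_lt hg.lintegral_lt_top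
    have ht' : t₀ < t := ht
    have ht0 : 0 < t := ht₀0.trans_lt ht'
    have he1 : 2 ≤ Real.exp t :=
      (Real.log_le_iff_le_exp two_pos).1 ((le_max_left _ _).trans ht'.le)
    have he2 : 2 / κ ≤ Real.exp t :=
      (Real.log_le_iff_le_exp (by positivity)).1 ((le_max_right _ _).trans ht'.le)
    have hκe : κ / 2 * Real.exp t ≤ κ * (Real.exp t - 1) := by nlinarith
    have h1 : 1 ≤ κ * (Real.exp t - 1) := by
      refine le_trans ?_ hκe
      rw [div_le_iff₀ hκ] at he2
      linarith
    refine ENNReal.ofReal_le_ofReal ((coverage_le hlam hμ hP hn hα (hpos t ht0)).trans ?_)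
    have h2 : (κ / 2 * Real.exp t) ^ (2 / α) * K ≤ 1 + rho (κ * (Real.exp t - 1)) α := by
      have h3 := rpow_mul_le_rho hα h1
      have h4 : (κ / 2 * Real.exp t) ^ (2 / α) * K ≤ (κ * (Real.exp t - 1)) ^ (2 / α) * K := by
        gcongr
      linarith
    refine (inv_anti₀ (by positivity) h2).trans_eq ?_
    rw [mul_inv, ← Real.rpow_neg (by positivity), Real.mul_rpow (by positivity) (by positivity),
      ← Real.exp_mul]
    ring_nf

end Coverage

end SFR

namespace SFR

open Filter Topology
open scoped ENNReal NNReal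

/-! ### The signal to interference plus noise ratio -/

variable {Ω : Type*} [MeasurableSpace Ω] {Pr : Measure Ω} {lam μ α P noise β η : ℝ}
  {X : ℕ → Ω → Plane} {g gNew : ℕ → Ω → ℝ}

lemma interferer_nonneg {Ω : Type*} (X : ℕ → Ω → Plane) {h : ℕ → Ω → ℝ} {ω : Ω}
    (hh : ∀ n, 0 < h n ω) (n : ℕ) : 0 ≤ interferer X h α ω n := by
  have := hh n
  unfold interferer
  split_ifs <;> positivity

lemma interference_pos {Ω : Type*} {X : ℕ → Ω → Plane} {h : ℕ → Ω → ℝ} {ω : Ω}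
    (hh : ∀ n, 0 < h n ω) (hX : ∀ n, X n ω ≠ 0) (hs : Summable (interferer X h α ω)) :
    0 < interference X h α ω := by
  refine hs.tsum_pos (interferer_nonneg X hh) (serving X ω + 1) ?_
  have h1 := hh (serving X ω + 1)
  have h2 := norm_pos_iff.2 (hX (serving X ω + 1))
  rw [interferer, if_neg (Nat.succ_ne_self _)]
  positivity

/-- Clear the denominator and multiply by `r^α`: the interferers get the relative weights `(T Q / S)
(r / R_n)^α`. Positive fading and summability allow the passage from real to extended sums. -/
lemma le_sinr_iff {Ω : Type*} {X : ℕ → Ω → Plane} {h : ℕ → Ω → ℝ} {ω : Ω} {S Q T : ℝ}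
    (hS : 0 < S) (hQ : 0 < Q) (hn : 0 ≤ noise) (hT : 0 ≤ T)
    (hh : ∀ n, 0 < h n ω) (hX : ∀ n, X n ω ≠ 0) (hs : Summable (interferer X h α ω)) :
    T ≤ sinr X h α S noise Q ω ↔
      (fun n => X n ω, fun n => h n ω) ∈ coverSet (T * Q / S) (T * noise / S) α := by
  have hI := interference_pos hh hX hs
  have hR : 0 < ‖X (serving X ω) ω‖ := norm_pos_iff.2 (hX _)
  have hR' : 0 < ‖X (serving X ω) ω‖ ^ α := by positivity
  have hh0 := hh (serving X ω)
  have hD : 0 < noise + Q * interference X h α ω := by positivity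
  have hterm : ∀ n, ENNReal.ofReal (interfWeight (T * Q / S) α (fun n => X n ω) n)
      * ENNReal.ofReal (h n ω) = ENNReal.ofReal
        (T * Q / S * ‖X (serving X ω) ω‖ ^ α * interferer X h α ω n) := by
    intro n
    rw [← ENNReal.ofReal_mul (interfWeight_nonneg (by positivity) _ _)]
    congr 1
    by_cases hns : n = serving X ω
    · have : n = servingIdx fun n => X n ω := hns
      rw [interfWeight, if_pos this, interferer, if_pos hns]
      simp
    · have : ¬ n = servingIdx fun n => X n ω := hns
      rw [interfWeight, if_neg this, interferer, if_neg hns,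
        Real.div_rpow (norm_nonneg _) (norm_nonneg _), Real.rpow_neg (norm_nonneg _)]
      change T * Q / S * (‖X (serving X ω) ω‖ ^ α / ‖X n ω‖ ^ α) * h n ω = _
      ring
  have hsum : ∑' n, ENNReal.ofReal (interfWeight (T * Q / S) α (fun n => X n ω) n)
      * ENNReal.ofReal (h n ω) = ENNReal.ofReal
        (T * Q / S * ‖X (serving X ω) ω‖ ^ α * interference X h α ω) := by
    simp_rw [hterm]
    rw [interference, ← tsum_mul_left, ENNReal.ofReal_tsum_of_nonneg (fun n =>
      mul_nonneg (by positivity) (interferer_nonneg X hh n)) (hs.mul_left _)]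
  have hmem : (fun n => X n ω, fun n => h n ω) ∈ coverSet (T * Q / S) (T * noise / S) α ↔
      ENNReal.ofReal (T * noise / S * ‖X (serving X ω) ω‖ ^ α)
        + ENNReal.ofReal (T * Q / S * ‖X (serving X ω) ω‖ ^ α * interference X h α ω)
      ≤ ENNReal.ofReal (h (serving X ω) ω) := by
    rw [← hsum]
    rfl
  rw [hmem, ← ENNReal.ofReal_add (by positivity) (by positivity),
    ENNReal.ofReal_le_ofReal_iff hh0.le, sinr, le_div_iff₀ hD, Real.rpow_neg hR.le,
    ← div_eq_mul_inv, le_div_iff₀ hR']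
  have : S * (T * noise / S * ‖X (serving X ω) ω‖ ^ α
      + T * Q / S * ‖X (serving X ω) ω‖ ^ α * interference X h α ω)
      = T * (noise + Q * interference X h α ω) * ‖X (serving X ω) ω‖ ^ α := by
    field_simp
  rw [← this, mul_le_mul_iff_right₀ hS]

lemma sinr_nonneg {Ω : Type*} {X : ℕ → Ω → Plane} {h : ℕ → Ω → ℝ} {ω : Ω} {S Q : ℝ}
    (hS : 0 ≤ S) (hQ : 0 ≤ Q) (hn : 0 ≤ noise) (hh : ∀ n, 0 < h n ω) :
    0 ≤ sinr X h α S noise Q ω := by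
  have h0 := hh (serving X ω)
  have hI : 0 ≤ interference X h α ω := tsum_nonneg (interferer_nonneg X hh)
  unfold sinr
  positivity

lemma aemeasurable_sinr {h : ℕ → Ω → ℝ} {S Q : ℝ} (hX : ∀ n, Measurable (X n))
    (hm : ∀ n, Measurable (h n)) (hh : ∀ᵐ ω ∂Pr, ∀ n, 0 < h n ω) :
    AEMeasurable (sinr X h α S noise Q) Pr := by
  have hXm : Measurable fun ω n => X n ω := measurable_pi_lambda _ hX
  have hhm : Measurable fun ω n => h n ω := measurable_pi_lambda _ hm
  have hs : Measurable (serving X) := by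
    have h1 := measurable_servingIdx.comp hXm
    exact h1
  have hR : Measurable fun ω => ‖X (serving X ω) ω‖ := by
    have h1 := measurable_norm_servingIdx.comp hXm
    exact h1
  have hg : Measurable fun ω => h (serving X ω) ω := by
    have h1 := measurable_apply_servingIdx.comp (hXm.prodMk hhm)
    exact h1
  have hi : ∀ n, Measurable fun ω => interferer X h α ω n := fun n =>
    Measurable.ite (measurableSet_eq_fun measurable_const hs) measurable_const
      ((hm n).mul ((hX n).norm.pow_const _))
  -- For nonnegative terms the real sum is the `toReal` of the extended one even without
  -- summability, both being `0` when the series diverges.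
  have hI : AEMeasurable (interference X h α) Pr := by
    refine ⟨fun ω => (∑' n, ENNReal.ofReal (interferer X h α ω n)).toReal,
      (Measurable.tsum fun n => (hi n).ennreal_ofReal).ennreal_toReal, ?_⟩
    filter_upwards [hh] with ω hω
    rw [ENNReal.tsum_toReal_eq fun n => ENNReal.ofReal_ne_top]
    exact tsum_congr fun n => (ENNReal.toReal_ofReal (interferer_nonneg X hω n)).symm
  have hgm := (hg.const_mul S).mul (hR.pow_const (-α))
  exact hgm.aemeasurable.div ((hI.const_mul Q).const_add noise)

namespace IsNetwork

lemma ae_summable (hnet : IsNetwork Pr lam μ X g gNew) (hlam : 0 ≤ lam) (hμ : 0 < μ)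
    (hα : 2 < α) :
    ∀ᵐ ω ∂Pr, Summable (interferer X g α ω) ∧ Summable (interferer X gNew α ω) := by
  have := hnet.indep_fading.isProbabilityMeasure
  filter_upwards [ae_summable_interferer hlam hμ hα hnet.poisson hnet.measurable_g hnet.law_g
      hnet.indepFun_location_g (ae_forall_pos hμ hnet.law_g),
    ae_summable_interferer hlam hμ hα hnet.poisson hnet.measurable_gNew hnet.law_gNew
      hnet.indepFun_location_gNew (ae_forall_pos hμ hnet.law_gNew)] with ω h1 h2
  exact ⟨h1, h2⟩

/-- The joint distribution of the two signal to interference plus noise ratios. -/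
theorem measure_le_sinr_inter (hnet : IsNetwork Pr lam μ X g gNew) (hlam : 0 < lam) (hμ : 0 < μ)
    (hα : 2 < α) (hP : 0 < P) (hn : 0 ≤ noise) (hβ : 0 < β) (hη : 0 < η) {s t : ℝ} (hs : 0 ≤ s)
    (ht : 0 ≤ t) :
    Pr ({ω | s ≤ sinr X gNew α (β * P) noise (η * P) ω} ∩ {ω | t ≤ sinr X g α P noise (η * P) ω})
      = ENNReal.ofReal (jointCoverage μ P (noise / η) (η / β * s) (η * t) lam α) := by
  rw [← hnet.measure_cover_inter_eq_jointCoverage hlam hμ hα hP (by positivity) (by positivity)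
    (by positivity)]
  refine measure_congr ?_
  filter_upwards [hnet.ae_summable hlam.le hμ hα, ae_forall_pos hμ hnet.law_g,
    ae_forall_pos hμ hnet.law_gNew, ae_ne_zero hlam.le hnet.poisson] with ω hsum hg hgNew hX
  have h1 := le_sinr_iff (α := α) (S := β * P) (Q := η * P) (by positivity) (by positivity) hn hs hgNew hX hsum.2
  have h2 := le_sinr_iff (α := α) (S := P) (Q := η * P) hP (by positivity) hn ht hg hX hsum.1
  -- The weights become `η s / β` and `η t`. The noise terms are these weights times `noise / (η
  -- P)`, which is the origin of `N = σ² / η`.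
  rw [show s * (η * P) / (β * P) = η / β * s by field_simp,
    show s * noise / (β * P) = η / β * s * (noise / η / P) by field_simp] at h1
  rw [show t * (η * P) / P = η * t by field_simp,
    show t * noise / P = η * t * (noise / η / P) by field_simp] at h2
  exact propext (and_congr h1 h2)

end IsNetwork

lemma one_le_effFactor {Δ : ℕ} (hΔ : 1 ≤ Δ) (hβ : 1 ≤ β) : 1 ≤ effFactor Δ β := by
  have : (1 : ℝ) ≤ Δ := by exact_mod_cast hΔ
  rw [effFactor, le_div_iff₀ (by linarith)]
  linarith

end SFR

namespace SFR

open Filter Topology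
open scoped ENNReal NNReal

/-! ### The rate of an edge user -/

section Rate

variable {Ω : Type*} [MeasurableSpace Ω] {Pr : Measure Ω} {lam μ α P noise β η TFR : ℝ}
  {X : ℕ → Ω → Plane} {g gNew : ℕ → Ω → ℝ}

lemma compl_edgeEvent {Ω : Type*} (X : ℕ → Ω → Plane) (g : ℕ → Ω → ℝ) (α P noise η TFR : ℝ) :
    (edgeEvent X g α P noise η TFR)ᶜ = {ω | TFR ≤ sinr X g α P noise (η * P) ω} := by
  ext ω
  simp [edgeEvent]

namespace IsNetwork

variable (hnet : IsNetwork Pr lam μ X g gNew)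
include hnet

lemma nullMeasurableSet_edgeEvent (hμ : 0 < μ) :
    NullMeasurableSet (edgeEvent X g α P noise η TFR) Pr :=
  (aemeasurable_sinr hnet.poisson.measurable hnet.measurable_g
    (ae_forall_pos hμ hnet.law_g)).nullMeasurableSet_preimage measurableSet_Iio

lemma aemeasurable_edgeRate (hμ : 0 < μ) : AEMeasurable (edgeRate X gNew α P noise η β) Pr :=
  Real.measurable_log.comp_aemeasurable ((aemeasurable_sinr hnet.poisson.measurable
    hnet.measurable_gNew (ae_forall_pos hμ hnet.law_gNew)).const_add 1)

lemma ae_edgeRate_nonneg (hμ : 0 < μ) (hP : 0 ≤ P) (hn : 0 ≤ noise) (hβ : 0 ≤ β) (hη : 0 ≤ η) :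
    0 ≤ᵐ[Pr] edgeRate X gNew α P noise η β := by
  filter_upwards [ae_forall_pos hμ hnet.law_gNew] with ω hω
  refine Real.log_nonneg ?_
  have := sinr_nonneg (X := X) (α := α) (S := β * P) (Q := η * P) (by positivity) (by positivity)
    hn hω
  linarith

variable (hlam : 0 < lam) (hμ : 0 < μ) (hα : 2 < α) (hP : 0 < P) (hn : 0 ≤ noise) (hβ : 0 < β)
  (hη : 0 < η)
include hlam hμ hα hP hn hβ hη

/-- The joint law at level `0` for the other sub-band, whose SINR is almost surely nonnegative. -/
lemma measure_le_sinr {t : ℝ} (ht : 0 < t) :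
    Pr {ω | t ≤ sinr X g α P noise (η * P) ω}
      = ENNReal.ofReal (coverage μ P (noise / η) (η * t) lam α 1) := by
  have h := hnet.measure_le_sinr_inter hlam hμ hα hP hn hβ hη le_rfl ht.le
  rw [mul_zero, jointCoverage_comm, ← coverage_eq_jointCoverage (by linarith) (by positivity)] at h
  rw [← h]
  refine measure_congr ?_
  filter_upwards [ae_forall_pos hμ hnet.law_gNew] with ω hω
  refine propext (iff_and_self.2 fun _ => ?_)
  exact sinr_nonneg (by positivity) (by positivity) hn hω

lemma measure_le_sinrNew {s : ℝ} (hs : 0 < s) :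
    Pr {ω | s ≤ sinr X gNew α (β * P) noise (η * P) ω}
      = ENNReal.ofReal (coverage μ P (noise / η) (η / β * s) lam α 1) := by
  have h := hnet.measure_le_sinr_inter hlam hμ hα hP hn hβ hη hs.le le_rfl
  rw [mul_zero, ← coverage_eq_jointCoverage (by linarith) (by positivity)] at h
  rw [← h]
  refine measure_congr ?_
  filter_upwards [ae_forall_pos hμ hnet.law_g] with ω hω
  refine propext (iff_self_and.2 fun _ => ?_)
  exact sinr_nonneg hP.le (by positivity) hn hω

/-- Both are probabilities, of an intersection and of one of its two events. -/
lemma jointCoverage_le_coverage {s t : ℝ} (hs : 0 < s) (ht : 0 ≤ t) :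
    jointCoverage μ P (noise / η) (η / β * s) (η * t) lam α
      ≤ coverage μ P (noise / η) (η / β * s) lam α 1 := by
  have h := measure_mono (μ := Pr) (inter_subset_left
    (s := {ω | s ≤ sinr X gNew α (β * P) noise (η * P) ω})
    (t := {ω | t ≤ sinr X g α P noise (η * P) ω}))
  rw [hnet.measure_le_sinr_inter hlam hμ hα hP hn hβ hη hs.le ht,
    hnet.measure_le_sinrNew hlam hμ hα hP hn hβ hη hs] at h
  refine (ENNReal.ofReal_le_ofReal_iff ?_).1 h
  rw [coverage_eq_jointCoverage (by linarith) (by positivity)]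
  exact jointCoverage_nonneg hlam.le

lemma measure_edgeEvent [IsProbabilityMeasure Pr] (hT : 0 < TFR) :
    Pr (edgeEvent X g α P noise η TFR)
      = ENNReal.ofReal (1 - coverage μ P (noise / η) (η * TFR) lam α 1) := by
  have h := prob_compl_eq_one_sub₀ (hnet.nullMeasurableSet_edgeEvent (α := α) (P := P)
    (noise := noise) (η := η) (TFR := TFR) hμ).compl
  rw [compl_compl, compl_edgeEvent, hnet.measure_le_sinr hlam hμ hα hP hn hβ hη hT] at h
  rw [h, ← ENNReal.ofReal_one, ENNReal.ofReal_sub]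
  rw [coverage_eq_jointCoverage (by linarith) (by positivity)]
  exact jointCoverage_nonneg hlam.le

/-- The tail of the rate on the event that the user is an edge user. -/
lemma measure_le_edgeRate_inter [IsProbabilityMeasure Pr] (hT : 0 < TFR) {t : ℝ} (ht : 0 < t) :
    Pr ({ω | t ≤ edgeRate X gNew α P noise η β ω} ∩ edgeEvent X g α P noise η TFR)
      = ENNReal.ofReal (coverage μ P (noise / η) (η / β * (Real.exp t - 1)) lam α 1
        - jointCoverage μ P (noise / η) (η / β * (Real.exp t - 1)) (η * TFR) lam α) := by
  have hs : 0 < Real.exp t - 1 := by linarith [Real.add_one_lt_exp ht.ne']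
  have hset : {ω | t ≤ edgeRate X gNew α P noise η β ω}
      =ᵐ[Pr] {ω | Real.exp t - 1 ≤ sinr X gNew α (β * P) noise (η * P) ω} := by
    filter_upwards [ae_forall_pos hμ hnet.law_gNew] with ω hω
    have h0 := sinr_nonneg (X := X) (α := α) (S := β * P) (Q := η * P) (by positivity)
      (by positivity) hn hω
    refine propext ?_
    change t ≤ Real.log (1 + _) ↔ _ ≤ _
    rw [Real.le_log_iff_exp_le (by linarith), sub_le_iff_le_add']
  refine (measure_congr (hset.inter (ae_eq_refl _))).trans ?_
  have hE := hnet.nullMeasurableSet_edgeEvent (α := α) (P := P) (noise := noise) (η := η)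
    (TFR := TFR) hμ
  -- The part outside the edge event is an intersection of two SINR tails; subtracting it leaves the
  -- part inside.
  have hsplit := measure_inter_add_sdiff₀
    {ω | Real.exp t - 1 ≤ sinr X gNew α (β * P) noise (η * P) ω} hE
  rw [sdiff_eq, compl_edgeEvent, hnet.measure_le_sinr_inter hlam hμ hα hP hn hβ hη hs.le hT.le,
    hnet.measure_le_sinrNew hlam hμ hα hP hn hβ hη hs] at hsplit
  rw [ENNReal.ofReal_sub _ (jointCoverage_nonneg hlam.le), ← hsplit,
    ENNReal.add_sub_cancel_right ENNReal.ofReal_ne_top]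

end IsNetwork

end Rate

end SFR

/-! ### From the tail of the rate to its conditional mean. -/

theorem theorem6 {Ω : Type*} [MeasurableSpace Ω] (Pr : Measure Ω) [IsProbabilityMeasure Pr]
    (lam μ α P σ β TFR : ℝ) (Δ : ℕ)
    (hlam : 0 < lam) (hμ : 0 < μ) (hα : 2 < α) (hP : 0 < P) (hβ : 1 ≤ β) (hTFR : 0 < TFR)
    (hΔ : 1 ≤ Δ)
    (X : ℕ → Ω → SFR.Plane) (g gNew : ℕ → Ω → ℝ)
    (hnet : SFR.IsNetwork Pr lam μ X g gNew) (η : ℝ) (hη : η = SFR.effFactor Δ β) :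
    -- the two interference series converge almost surely
    (∀ᵐ ω ∂Pr, Summable (SFR.interferer X g α ω) ∧ Summable (SFR.interferer X gNew α ω)) ∧
    -- being an edge user has positive probability, and the rate has a finite conditional mean
    0 < Pr (SFR.edgeEvent X g α P (σ ^ 2) η TFR) ∧
    Integrable (SFR.edgeRate X gNew α P (σ ^ 2) η β)
      (ProbabilityTheory.cond Pr (SFR.edgeEvent X g α P (σ ^ 2) η TFR)) ∧
    -- the right-hand side is a convergent integral with a positive denominator
    0 < 1 - SFR.coverage μ P (σ ^ 2 / η) (η * TFR) lam α 1 ∧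
    IntegrableOn (SFR.rateIntegrand μ P (σ ^ 2 / η) lam α η β TFR) (Ioi 0) ∧
    -- the rate formula
    ∫ ω, SFR.edgeRate X gNew α P (σ ^ 2) η β ω
        ∂(ProbabilityTheory.cond Pr (SFR.edgeEvent X g α P (σ ^ 2) η TFR))
      = ∫ t in Ioi (0 : ℝ), SFR.rateIntegrand μ P (σ ^ 2 / η) lam α η β TFR t := by
  have hη0 : 0 < η := by linarith [SFR.one_le_effFactor hΔ hβ]
  have hβ0 : 0 < β := by linarith
  have hn : 0 ≤ σ ^ 2 := sq_nonneg σ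
  set E := SFR.edgeEvent X g α P (σ ^ 2) η TFR with hE
  set f := SFR.edgeRate X gNew α P (σ ^ 2) η β with hf
  have hden : 0 < 1 - SFR.coverage μ P (σ ^ 2 / η) (η * TFR) lam α 1 :=
    sub_pos.2 (SFR.coverage_lt_one hlam hμ.le hP.le (by positivity) hα (by positivity))
  have hPrE := hnet.measure_edgeEvent hlam hμ hα hP hn hβ0 hη0 hTFR
  have hfm : AEMeasurable f (Pr.restrict E) := (hnet.aemeasurable_edgeRate hμ).restrict
  have hf0 : 0 ≤ᵐ[Pr.restrict E] f :=
    ae_restrict_of_ae (hnet.ae_edgeRate_nonneg hμ hP.le hn hβ0.le hη0.le)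
  have htail : ∀ t ∈ Ioi (0 : ℝ), (Pr.restrict E) {ω | t ≤ f ω}
      = ENNReal.ofReal (SFR.coverage μ P (σ ^ 2 / η) (η / β * (Real.exp t - 1)) lam α 1
        - SFR.jointCoverage μ P (σ ^ 2 / η) (η / β * (Real.exp t - 1)) (η * TFR) lam α) := by
    intro t ht
    refine (Measure.restrict_apply₀ (hfm.nullMeasurableSet_preimage measurableSet_Ici)).trans ?_
    exact hnet.measure_le_edgeRate_inter hlam hμ hα hP hn hβ0 hη0 hTFR ht
  -- This one finite tail integral yields both the integrability of the rate and the convergence of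
  -- the right-hand side.
  have hlt : ∫⁻ t in Ioi (0 : ℝ), (Pr.restrict E) {ω | t ≤ f ω} < ⊤ := by
    refine (setLIntegral_mono' measurableSet_Ioi fun t ht => ?_).trans_lt
      (SFR.lintegral_coverage_lt_top (noise := σ ^ 2 / η) hlam hμ.le hP.le (by positivity) hα
        (κ := η / β) (by positivity))
    rw [htail t ht]
    exact ENNReal.ofReal_le_ofReal (sub_le_self _ (SFR.jointCoverage_nonneg hlam.le))
  have hint : Integrable f (Pr.restrict E) := by
    refine ⟨hfm.aestronglyMeasurable, ?_⟩
    rw [hasFiniteIntegral_iff_ofReal hf0, lintegral_eq_lintegral_meas_le _ hf0 hfm]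
    exact hlt
  have hanti : Antitone fun t : ℝ => (Pr.restrict E) {ω | t ≤ f ω} := fun s t hst =>
    measure_mono fun ω (hω : t ≤ f ω) => hst.trans hω
  have htint : IntegrableOn (fun t : ℝ => (Pr.restrict E).real {ω | t ≤ f ω}) (Ioi 0) :=
    integrable_toReal_of_lintegral_ne_top hanti.measurable.aemeasurable hlt.ne
  have hnum : ∀ t ∈ Ioi (0 : ℝ), SFR.rateIntegrand μ P (σ ^ 2 / η) lam α η β TFR t
      = (1 - SFR.coverage μ P (σ ^ 2 / η) (η * TFR) lam α 1)⁻¹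
        * (Pr.restrict E).real {ω | t ≤ f ω} := by
    intro t ht
    -- Nonnegativity of the numerator ensures that `ENNReal.ofReal` in `htail` truncates nothing.
    have hle := hnet.jointCoverage_le_coverage hlam hμ hα hP hn hβ0 hη0
      (s := Real.exp t - 1) (sub_pos.2 (Real.one_lt_exp_iff.2 ht)) hTFR.le
    rw [measureReal_def, htail t ht, ENNReal.toReal_ofReal (sub_nonneg.2 hle), SFR.rateIntegrand, div_eq_inv_mul]
  refine ⟨hnet.ae_summable hlam.le hμ hα, ?_, ?_, hden, ?_, ?_⟩
  · rw [hPrE]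
    exact ENNReal.ofReal_pos.2 hden
  · refine hint.smul_measure ?_
    rw [hPrE]
    simpa using hden
  · exact IntegrableOn.congr_fun (htint.const_mul _) (fun t ht => (hnum t ht).symm) measurableSet_Ioi
  -- The conditional measure is the restriction to `E` divided by `Pr E`, which is the denominator;
  -- the rest is the layer-cake formula.
  · rw [setIntegral_congr_fun measurableSet_Ioi hnum, integral_const_mul,
      ← hint.integral_eq_integral_meas_le hf0, ProbabilityTheory.cond, integral_smul_measure, hPrE,
      ENNReal.toReal_inv, ENNReal.toReal_ofReal hden.le, smul_eq_mul]
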